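/- **Setting.** Let $\mathbf h,\mathcal H$ be separable complex Hilbert spaces (inner products antilinear in the first variable), $\Omega\in\mathcal H$ a unit vector, and $\{U_{s,t}:0\le s\le t<\infty\}$ unitary operators on the Hilbert space tensor product $\mathbf h\otimes\mathcal H$; write $U_t=U_{0,t}$. For a bounded operator $A$ on $\mathbf h\otimes\mathcal H$ and $u,v\in\mathbf h$ let $A(u,v)\in\mathcal B(\mathcal H)$ be given by $\langle\xi_1,A(u,v)\xi_2\rangle=\langle u\otimes\xi_1,A(v\otimes\xi_2)\rangle$; let $A^{(0)}=A$, $A^{(1)}=A^*$. Assume: * **A1** $U_{r,s}U_{s,t}=U_{r,t}$ for $0\le r\le s\le t$. * **A2** If $0\le s_i\le t_i$ ($i=1,2$) and $[s_1,t_1)\cap[s_2,t_2)=\emptyset$, then (i) $U_{s_1,t_1}(u_1,v_1)$ commutes with $U_{s_2,t_2}(u_2,v_2)$ and $U_{s_2,t_2}^*(u_2,v_2)$ for all $u_i,v_i\in\mathbf h$; (ii) $\langle\Omega,XY\Omega\rangle=\langle\Omega,X\Omega\rangle\langle\Omega,Y\Omega\rangle$ whenever $X=\prod_{k=1}^nU^{(\epsilon_k)}_{a_k,b_k}(u_k,v_k)$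 and $Y=\prod_{l=1}^mU^{(\epsilon'_l)}_{q_l,r_l}(p_l,w_l)$, where the intervals $[a_k,b_k]\subseteq[s_1,t_1]$ are listed in temporal order with repetitions allowed (for $i<j$ either $[a_i,b_i]=[a_j,b_j]$ or $b_i\le a_j$), and likewise $[q_l,r_l]\subseteq[s_2,t_2]$; all $\epsilon_k,\epsilon_l'\in\{0,1\}$ and all vectors in $\mathbf h$ are arbitrary. * **A3** For $0\le s\le t$, $\langle\Omega,\prod_{k=1}^nU_{s,t}^{(\epsilon_k)}(u_k,v_k)\Omega\rangle=\langle\Omega,\prod_{k=1}^nU_{t-s}^{(\epsilon_k)}(u_k,v_k)\Omega\rangle$. * **B′** $\lim_{t\to0}\langle\Omega,(U_t-1)(u,v)\Omega\rangle=0$ for all $u,v\in\mathbf h$. * **C** $\lim_{t\to0}\frac1t\langle\Omega,(U_t^{(\epsilon_1)}-1)(u_1,v_1)(U_t^{(\epsilon_2)}-1)(u_2,v_2)(U_t^{(\epsilon_3)}-1)(u_3,v_3)\Omega\rangle=0$ for all $u_i,v_i\in\mathbf h$, $\epsilon_i\in\{0,1\}$. Let $G$ be the generator of the semigroup $T_t$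 on $\mathbf h$ given by $\langle u,T_tv\rangle=\langle\Omega,U_t(u,v)\Omega\rangle$. On the trace class operators $\mathcal B_1(\mathbf h)$, with the trace norm, let $\mathcal L$ and $\mathcal L'$ be the generators of $$Z_t\rho=\mathrm{Tr}_{\mathcal H}[U_t(\rho\otimes|\Omega\rangle\langle\Omega|)U_t^*],\qquad F_t\rho=\mathrm{Tr}_{\mathcal H}[U_t^*(\rho\otimes|\Omega\rangle\langle\Omega|)U_t].$$ **Assumption E2.** There is a dense subspace $\mathcal D\subseteq\mathcal D(G)\cap\mathcal D(G^*)$ that is a core for $G$ and such that $\mathrm{Span}\{|u\rangle\langle v|:u,v\in\mathcal D\}$ is a core for $\mathcal L$ and for $\mathcal L'$. Fix such a $\mathcal D$. **Coefficients.** Let $\mathbf k$ be the Hilbert space generated by vectors $\eta(\underline u,\underline v,\underline\epsilon)$, for $n\ge1$, $\underline u\in\mathbf h^n$, $\underline v\in\mathcal D^n$, $\underline\epsilon\in\{0,1\}^n$, with $$\langle\eta(\underline u,\underline v,\underline\epsilon),\eta(\underline p,\underline w,\underline\epsilon')\rangle=\lim_{t\to0}\tfrac1t\big\langle(U_t^{(\underline\epsilon)}-1)(\underline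 u,\underline v)\Omega,(U_t^{(\underline\epsilon')}-1)(\underline p,\underline w)\Omega\big\rangle,$$ where $(U_t^{(\underline\epsilon)}-1)(\underline u,\underline v)=\prod_iU_t^{(\epsilon_i)}(u_i,v_i)-\prod_i\langle u_i,v_i\rangle$. Fix an orthonormal basis $(E_j)_j$ of $\mathbf k$ and let $L_j:\mathcal D\to\mathbf h$ be the operators with $\langle u,L_jv\rangle=\langle E_j,\eta(u,v,0)\rangle$ for $u\in\mathbf h$, $v\in\mathcal D$. For $\lambda>0$ let $\beta_\lambda$ be the set of positive $x\in\mathcal B(\mathbf h)$ such that $$\langle v,xGw\rangle+\langle Gv,xw\rangle+\sum_j\langle L_jv,xL_jw\rangle=\lambda\langle v,xw\rangle\qquad\text{for all }v,w\in\mathcal D,$$ and let $\tilde\beta_\lambda$ be the set of positive $x\in\mathcal B(\mathbf h)$ satisfying the same identity with $G^*$ in place of $G$. **Lemma.** For some $\lambda>0$, $\beta_\lambda=\{0\}$ and $\tilde\beta_\lambda=\{0\}$. -/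

import Mathlib

open Filter Topology
open scoped InnerProductSpace TensorProduct ENNReal

noncomputable section

namespace QUnitary

/-! ### Trace class operators -/

section TraceClass

variable {E : Type*} [NormedAddCommGroup E] [InnerProductSpace ℂ E]
variable {F : Type*} [NormedAddCommGroup F] [InnerProductSpace ℂ F]

/-- The trace norm `‖ρ‖₁`, the supremum of `∑ₖ |⟨φₖ, ρ ψₖ⟩|` over all pairs `φ`, `ψ` of
orthonormal systems. (Finite orthonormal systems give the same supremum as orthonormal bases.) -/
def traceNorm (ρ : E →L[ℂ] E) : ℝ≥0∞ :=
  ⨆ (n : ℕ) (φ : Fin n → E) (ψ : Fin n → E) (_ : Orthonormal ℂ φ) (_ : Orthonormal ℂ ψ),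
    ENNReal.ofReal (∑ k, ‖⟪φ k, ρ (ψ k)⟫_ℂ‖)

lemma traceNorm_le {ρ : E →L[ℂ] E} {C : ℝ}
    (h : ∀ (n : ℕ) (φ ψ : Fin n → E), Orthonormal ℂ φ → Orthonormal ℂ ψ →
      ∑ k, ‖⟪φ k, ρ (ψ k)⟫_ℂ‖ ≤ C) : traceNorm ρ ≤ ENNReal.ofReal C :=
  iSup_le fun n => iSup_le fun φ => iSup_le fun ψ => iSup_le fun hφ => iSup_le fun hψ =>
    ENNReal.ofReal_le_ofReal (h n φ ψ hφ hψ)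

lemma toReal_traceNorm_le {ρ : E →L[ℂ] E} {C : ℝ} (hC : 0 ≤ C)
    (h : ∀ (n : ℕ) (φ ψ : Fin n → E), Orthonormal ℂ φ → Orthonormal ℂ ψ →
      ∑ k, ‖⟪φ k, ρ (ψ k)⟫_ℂ‖ ≤ C) : (traceNorm ρ).toReal ≤ C :=
  ENNReal.toReal_le_of_le_ofReal hC (traceNorm_le h)

lemma sum_le_traceNorm {ρ : E →L[ℂ] E} (hρ : traceNorm ρ ≠ ⊤) {ι : Type*} [Fintype ι]
    {φ ψ : ι → E} (hφ : Orthonormal ℂ φ) (hψ : Orthonormal ℂ ψ) :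
    ∑ k, ‖⟪φ k, ρ (ψ k)⟫_ℂ‖ ≤ (traceNorm ρ).toReal := by
  have e := Fintype.equivFin ι
  rw [← ENNReal.ofReal_le_iff_le_toReal hρ, ← e.symm.sum_comp]
  exact le_iSup_of_le (Fintype.card ι) <| le_iSup_of_le (φ ∘ e.symm) <|
    le_iSup_of_le (ψ ∘ e.symm) <| le_iSup_of_le (hφ.comp _ e.symm.injective) <|
    le_iSup_of_le (hψ.comp _ e.symm.injective) le_rfl

lemma traceNorm_add_le {ρ σ : E →L[ℂ] E} (hρ : traceNorm ρ ≠ ⊤) (hσ : traceNorm σ ≠ ⊤) :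
    traceNorm (ρ + σ) ≤ ENNReal.ofReal ((traceNorm ρ).toReal + (traceNorm σ).toReal) := by
  refine traceNorm_le fun n φ ψ hφ hψ => ?_
  refine le_trans (Finset.sum_le_sum fun k _ => ?_)
    (Finset.sum_add_distrib.le.trans
      (add_le_add (sum_le_traceNorm hρ hφ hψ) (sum_le_traceNorm hσ hφ hψ)))
  rw [add_apply, inner_add_right]
  exact norm_add_le _ _

lemma traceNorm_smul_le {ρ : E →L[ℂ] E} (hρ : traceNorm ρ ≠ ⊤) (c : ℂ) :
    traceNorm (c • ρ) ≤ ENNReal.ofReal (‖c‖ * (traceNorm ρ).toReal) := by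
  refine traceNorm_le fun n φ ψ hφ hψ => ?_
  have : ∑ k, ‖⟪φ k, (c • ρ) (ψ k)⟫_ℂ‖ = ‖c‖ * ∑ k, ‖⟪φ k, ρ (ψ k)⟫_ℂ‖ := by
    simp [Finset.mul_sum]
  rw [this]
  exact mul_le_mul_of_nonneg_left (sum_le_traceNorm hρ hφ hψ) (norm_nonneg c)

lemma traceNorm_zero : traceNorm (0 : E →L[ℂ] E) = 0 := by
  have : traceNorm (0 : E →L[ℂ] E) ≤ ENNReal.ofReal 0 :=
    traceNorm_le fun n φ ψ _ _ => by simp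
  simpa using this

variable (E) in
/-- The operators with finite trace norm, as a subspace of the bounded operators. -/
def traceClassSubmodule : Submodule ℂ (E →L[ℂ] E) where
  carrier := {ρ | traceNorm ρ ≠ ⊤}
  zero_mem' := by simp [traceNorm_zero]
  add_mem' hρ hσ := ne_top_of_le_ne_top ENNReal.ofReal_ne_top (traceNorm_add_le hρ hσ)
  smul_mem' c _ hρ := ne_top_of_le_ne_top ENNReal.ofReal_ne_top (traceNorm_smul_le hρ c)

variable (E) in
/-- The space of trace class operators on `E`; it carries the trace norm. -/
def TraceClass : Type _ := ↥(traceClassSubmodule E)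

namespace TraceClass

instance : AddCommGroup (TraceClass E) := inferInstanceAs (AddCommGroup ↥(traceClassSubmodule E))

instance : Module ℂ (TraceClass E) := inferInstanceAs (Module ℂ ↥(traceClassSubmodule E))

variable (E) in
/-- A trace class operator regarded as a bounded operator. -/
def toOp : TraceClass E →ₗ[ℂ] (E →L[ℂ] E) := (traceClassSubmodule E).subtype

/-- An operator of finite trace norm, as a trace class operator. -/
def mk (ρ : E →L[ℂ] E) (h : traceNorm ρ ≠ ⊤) : TraceClass E := ⟨ρ, h⟩

@[simp] lemma toOp_mk (ρ : E →L[ℂ] E) (h : traceNorm ρ ≠ ⊤) : toOp E (mk ρ h) = ρ := rfl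

lemma toOp_injective : Function.Injective (toOp E) := Subtype.val_injective

lemma traceNorm_ne_top (ρ : TraceClass E) : traceNorm (toOp E ρ) ≠ ⊤ := ρ.2

instance : Norm (TraceClass E) := ⟨fun ρ => (traceNorm (toOp E ρ)).toReal⟩

lemma norm_def (ρ : TraceClass E) : ‖ρ‖ = (traceNorm (toOp E ρ)).toReal := rfl

lemma sum_le_norm (ρ : TraceClass E) {ι : Type*} [Fintype ι]
    {φ ψ : ι → E} (hφ : Orthonormal ℂ φ) (hψ : Orthonormal ℂ ψ) :
    ∑ k, ‖⟪φ k, toOp E ρ (ψ k)⟫_ℂ‖ ≤ ‖ρ‖ :=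
  sum_le_traceNorm ρ.traceNorm_ne_top hφ hψ

lemma orthonormal_normalize {w : E} (hw : w ≠ 0) :
    Orthonormal ℂ (fun _ : Fin 1 => ((‖w‖ : ℂ)⁻¹ • w)) := by
  refine ⟨fun _ => ?_, fun i j hij => (hij (Subsingleton.elim i j)).elim⟩
  have : ‖w‖ ≠ 0 := norm_ne_zero_iff.2 hw
  simp [norm_smul, this]

lemma norm_inner_le (ρ : TraceClass E) (u v : E) :
    ‖⟪u, toOp E ρ v⟫_ℂ‖ ≤ ‖u‖ * ‖v‖ * ‖ρ‖ := by
  by_cases hu : u = 0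
  · simp [hu]
  by_cases hv : v = 0
  · simp [hv]
  have h := ρ.sum_le_norm (orthonormal_normalize hu) (orthonormal_normalize hv)
  have hu' : 0 < ‖u‖ := norm_pos_iff.2 hu
  have hv' : 0 < ‖v‖ := norm_pos_iff.2 hv
  simp only [Finset.univ_unique, Finset.sum_singleton, map_smul, inner_smul_left,
    inner_smul_right, norm_mul, norm_inv, RCLike.norm_conj, Complex.norm_real, norm_norm] at h
  rw [← mul_assoc, ← mul_inv, inv_mul_le_iff₀ (by positivity)] at h
  linarith [h]

lemma normCore : NormedSpace.Core ℂ (TraceClass E) where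
  norm_nonneg ρ := ENNReal.toReal_nonneg
  norm_smul c ρ := by
    have key : ∀ (c : ℂ) (ρ : TraceClass E), ‖c • ρ‖ ≤ ‖c‖ * ‖ρ‖ := fun c ρ =>
      ENNReal.toReal_le_of_le_ofReal (mul_nonneg (norm_nonneg c) ENNReal.toReal_nonneg)
        (traceNorm_smul_le ρ.traceNorm_ne_top c)
    refine le_antisymm (key c ρ) ?_
    by_cases hc : c = 0
    · subst hc
      rw [norm_zero, zero_mul]
      exact ENNReal.toReal_nonneg
    · have h := key c⁻¹ (c • ρ)
      rw [inv_smul_smul₀ hc, norm_inv] at h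
      rwa [inv_mul_eq_div, le_div_iff₀ (norm_pos_iff.2 hc), mul_comm] at h
  norm_triangle ρ σ :=
    ENNReal.toReal_le_of_le_ofReal (add_nonneg ENNReal.toReal_nonneg ENNReal.toReal_nonneg)
      (traceNorm_add_le ρ.traceNorm_ne_top σ.traceNorm_ne_top)
  norm_eq_zero_iff ρ := by
    refine ⟨fun h => toOp_injective ?_, fun h => by simp [h, norm_def, traceNorm_zero]⟩
    rw [map_zero]
    ext v
    refine ext_inner_left ℂ fun u => ?_
    have := ρ.norm_inner_le u v
    rw [h, mul_zero] at this
    simpa using this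

instance : NormedAddCommGroup (TraceClass E) := NormedAddCommGroup.ofCore normCore

instance : NormedSpace ℂ (TraceClass E) := NormedSpace.ofCore normCore

lemma sum_norm_inner_mul_le {ι : Type*} [Fintype ι] {φ ψ : ι → E}
    (hφ : Orthonormal ℂ φ) (hψ : Orthonormal ℂ ψ) (a b : E) :
    ∑ k, ‖⟪φ k, a⟫_ℂ‖ * ‖⟪ψ k, b⟫_ℂ‖ ≤ ‖a‖ * ‖b‖ := by
  refine (Real.sum_mul_le_sqrt_mul_sqrt _ _ _).trans ?_
  gcongr
  · exact Real.sqrt_le_iff.2 ⟨norm_nonneg _, hφ.sum_inner_products_le a⟩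
  · exact Real.sqrt_le_iff.2 ⟨norm_nonneg _, hψ.sum_inner_products_le b⟩

/-- The rank one operator `|w⟩⟨v|`, as a trace class operator. -/
def rankOne (w v : E) : TraceClass E :=
  mk (InnerProductSpace.rankOne ℂ w v) <|
    ne_top_of_le_ne_top ENNReal.ofReal_ne_top <|
      traceNorm_le (C := ‖w‖ * ‖v‖) fun n φ ψ hφ hψ => by
        refine le_trans (Finset.sum_le_sum fun k _ => ?_) (sum_norm_inner_mul_le hφ hψ w v)
        rw [InnerProductSpace.rankOne_apply, inner_smul_right, norm_mul, norm_inner_symm v, mul_comm]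

@[simp] lemma toOp_rankOne (w v u : E) : toOp E (rankOne w v) u = ⟪v, u⟫_ℂ • w := by
  simp [rankOne]

/-- Singular value decomposition of the compression to a finite dimensional subspace. -/
lemma exists_decomp (ρ : TraceClass E) (S : Submodule ℂ E) [FiniteDimensional ℂ S] :
    ∃ (n : ℕ) (a b : Fin n → E), (∀ x ∈ S, ∀ y ∈ S,
      ⟪x, toOp E ρ y⟫_ℂ = ∑ i, ⟪x, a i⟫_ℂ * ⟪b i, y⟫_ℂ) ∧ ∑ i, ‖a i‖ * ‖b i‖ ≤ ‖ρ‖ := by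
  classical
  set T₀ : S →ₗ[ℂ] S :=
    (S.orthogonalProjectionOnto : E →ₗ[ℂ] S) ∘ₗ (toOp E ρ : E →ₗ[ℂ] E) ∘ₗ S.subtype with hT₀
  have hin : ∀ x y : S, ⟪x, T₀ y⟫_ℂ = ⟪(x : E), toOp E ρ y⟫_ℂ := fun x y => by
    simp [hT₀]
  set T : S →ₗ[ℂ] S := LinearMap.adjoint T₀ ∘ₗ T₀ with hT
  have hsymm : T.IsSymmetric := fun x y => by
    simp [hT, LinearMap.adjoint_inner_left, LinearMap.adjoint_inner_right]
  set b := hsymm.eigenvectorBasis (rfl : Module.finrank ℂ S = Module.finrank ℂ S) with hb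
  have horth : ∀ i j, i ≠ j → ⟪T₀ (b i), T₀ (b j)⟫_ℂ = 0 := fun i j hij => by
    rw [← LinearMap.adjoint_inner_right]
    change ⟪b i, T (b j)⟫_ℂ = 0
    rw [hb, hsymm.apply_eigenvectorBasis, inner_smul_right, ← hb, b.orthonormal.2 hij, mul_zero]
  refine ⟨_, fun i => (T₀ (b i) : E), fun i => (b i : E), fun x hx y hy => ?_, ?_⟩
  · have h1 := hin ⟨x, hx⟩ ⟨y, hy⟩
    rw [← h1]
    conv_lhs => rw [← b.sum_repr' ⟨y, hy⟩]
    simp only [map_sum, map_smul, inner_sum, inner_smul_right]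
    exact Finset.sum_congr rfl fun i _ => mul_comm _ _
  · set I := {i // T₀ (b i) ≠ 0}
    have hpos : ∀ i : I, ‖T₀ (b i)‖ ≠ 0 := fun i => norm_ne_zero_iff.2 i.2
    have hφ : Orthonormal ℂ (fun i : I => ((‖T₀ (b i)‖ : ℂ)⁻¹ • (T₀ (b i) : E))) := by
      refine ⟨fun i => ?_, fun i j hij => ?_⟩
      · have := hpos i
        rw [norm_smul, norm_inv, Complex.norm_real, norm_norm]
        exact inv_mul_cancel₀ this
      · have := horth i j (fun h => hij (Subtype.ext h))
        rw [Submodule.coe_inner] at this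
        simp [inner_smul_left, inner_smul_right, this]
    have hψ : Orthonormal ℂ (fun i : I => (b i : E)) := by
      have h1 : Orthonormal ℂ (fun i => (b i : E)) := b.orthonormal.comp_linearIsometry S.subtypeₗᵢ
      exact h1.comp _ Subtype.val_injective
    refine le_trans (le_of_eq ?_) (ρ.sum_le_norm hφ hψ)
    have hb1 : ∀ i, ‖(b i : E)‖ = 1 := fun i => b.orthonormal.1 i
    simp only [hb1, mul_one]
    have hterm : ∀ i : I, ‖⟪((‖T₀ (b i)‖ : ℂ)⁻¹ • (T₀ (b i) : E)), toOp E ρ (b i)⟫_ℂ‖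
        = ‖(T₀ (b i) : E)‖ := fun i => by
      rw [inner_smul_left, ← hin, inner_self_eq_norm_sq_to_K, norm_mul, RCLike.norm_conj, norm_inv,
        norm_pow]
      have := hpos i
      simp only [Complex.norm_real, norm_norm, Complex.coe_algebraMap, Submodule.coe_norm]
      simp only [Submodule.coe_norm] at this
      field_simp
    simp only [hterm]
    rw [← Finset.sum_subtype (Finset.univ.filter fun i => T₀ (b i) ≠ 0) (by simp)
      (fun i => ‖(T₀ (b i) : E)‖)]
    refine (Finset.sum_filter_of_ne fun i _ hi => ?_).symm
    exact fun h0 => hi (by rw [h0, Submodule.coe_zero, norm_zero])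

section maps

variable [CompleteSpace E] [CompleteSpace F]

open ContinuousLinearMap (adjoint)

lemma sum_sandwich_le (V : E →L[ℂ] F) (ρ : TraceClass E) {n : ℕ} {φ ψ : Fin n → F}
    (hφ : Orthonormal ℂ φ) (hψ : Orthonormal ℂ ψ) :
    ∑ k, ‖⟪φ k, (V ∘L toOp E ρ ∘L adjoint V) (ψ k)⟫_ℂ‖ ≤ ‖V‖ ^ 2 * ‖ρ‖ := by
  set S : Submodule ℂ E := Submodule.span ℂ
    (Set.range (fun k => adjoint V (φ k)) ∪ Set.range (fun k => adjoint V (ψ k))) with hS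
  have : FiniteDimensional ℂ S :=
    FiniteDimensional.span_of_finite ℂ ((Set.finite_range _).union (Set.finite_range _))
  obtain ⟨m, a, b, hab, hle⟩ := ρ.exists_decomp S
  have hterm : ∀ k, ‖⟪φ k, (V ∘L toOp E ρ ∘L adjoint V) (ψ k)⟫_ℂ‖
      ≤ ∑ i, ‖⟪φ k, V (a i)⟫_ℂ‖ * ‖⟪ψ k, V (b i)⟫_ℂ‖ := fun k => by
    have h1 : ⟪φ k, (V ∘L toOp E ρ ∘L adjoint V) (ψ k)⟫_ℂ
        = ⟪adjoint V (φ k), toOp E ρ (adjoint V (ψ k))⟫_ℂ := by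
      rw [ContinuousLinearMap.adjoint_inner_left]; rfl
    rw [h1, hab _ (Submodule.subset_span (Or.inl ⟨k, rfl⟩)) _
      (Submodule.subset_span (Or.inr ⟨k, rfl⟩))]
    refine (norm_sum_le _ _).trans (Finset.sum_le_sum fun i _ => ?_)
    rw [norm_mul, ContinuousLinearMap.adjoint_inner_left, ContinuousLinearMap.adjoint_inner_right,
      norm_inner_symm (ψ k)]
  refine (Finset.sum_le_sum fun k _ => hterm k).trans ?_
  rw [Finset.sum_comm]
  calc ∑ i, ∑ k, ‖⟪φ k, V (a i)⟫_ℂ‖ * ‖⟪ψ k, V (b i)⟫_ℂ‖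
      ≤ ∑ i, ‖V‖ ^ 2 * (‖a i‖ * ‖b i‖) := Finset.sum_le_sum fun i _ => by
        refine (sum_norm_inner_mul_le hφ hψ _ _).trans ?_
        calc ‖V (a i)‖ * ‖V (b i)‖ ≤ (‖V‖ * ‖a i‖) * (‖V‖ * ‖b i‖) := by
              gcongr <;> exact V.le_opNorm _
          _ = _ := by ring
    _ ≤ _ := by
        rw [← Finset.mul_sum]
        gcongr

/-- The map `ρ ↦ V ρ V*` on trace class operators. -/
def sandwich (V : E →L[ℂ] F) : TraceClass E →L[ℂ] TraceClass F :=
  LinearMap.mkContinuous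
    { toFun := fun ρ => mk (V ∘L toOp E ρ ∘L adjoint V)
        (ne_top_of_le_ne_top ENNReal.ofReal_ne_top
          (traceNorm_le fun _ _ _ hφ hψ => sum_sandwich_le V ρ hφ hψ))
      map_add' := fun ρ σ => toOp_injective (by ext x; simp)
      map_smul' := fun c ρ => toOp_injective (by ext x; simp) }
    (‖V‖ ^ 2) fun ρ => toReal_traceNorm_le (mul_nonneg (sq_nonneg _) (norm_nonneg ρ))
      fun _ _ _ hφ hψ => sum_sandwich_le V ρ hφ hψ

@[simp] lemma toOp_sandwich (V : E →L[ℂ] F) (ρ : TraceClass E) :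
    toOp F (sandwich V ρ) = V ∘L toOp E ρ ∘L adjoint V := rfl

end maps

end TraceClass

end TraceClass

/-! ### Hilbert space tensor products and partial trace -/

section Tensor

variable (E F : Type*) [NormedAddCommGroup E] [InnerProductSpace ℂ E]
variable [NormedAddCommGroup F] [InnerProductSpace ℂ F]

/-- The Hilbert space tensor product `E ⊗ F` (completed). -/
abbrev HTensor : Type _ := UniformSpace.Completion (E ⊗[ℂ] F)

variable {E F}

/-- The product vector `u ⊗ ξ`. -/
def tmul (u : E) (ξ : F) : HTensor E F := ((u ⊗ₜ[ℂ] ξ : E ⊗[ℂ] F) : HTensor E F)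

variable (F) in
/-- The map `ξ ↦ u ⊗ ξ`. -/
def tmulLeft (u : E) : F →L[ℂ] HTensor E F :=
  UniformSpace.Completion.toComplL ∘L TensorProduct.mkL ℂ E F u

variable (E) in
/-- The map `u ↦ u ⊗ ξ`. -/
def tmulRight (ξ : F) : E →L[ℂ] HTensor E F :=
  UniformSpace.Completion.toComplL ∘L (TensorProduct.mkL ℂ E F).flip ξ

@[simp] lemma tmulLeft_apply (u : E) (ξ : F) : tmulLeft F u ξ = tmul u ξ := rfl

@[simp] lemma tmulRight_apply (u : E) (ξ : F) : tmulRight E ξ u = tmul u ξ := rfl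

@[simp] lemma inner_tmul (u u' : E) (ξ ξ' : F) :
    ⟪tmul u ξ, tmul u' ξ'⟫_ℂ = ⟪u, u'⟫_ℂ * ⟪ξ, ξ'⟫_ℂ := by
  simp [tmul]

lemma orthonormal_tmul {ι κ : Type*} {φ : ι → E} {ξ : κ → F} (hφ : Orthonormal ℂ φ)
    (hξ : Orthonormal ℂ ξ) : Orthonormal ℂ (fun p : ι × κ => tmul (φ p.1) (ξ p.2)) := by
  classical
  rw [orthonormal_iff_ite] at *
  rintro ⟨i, j⟩ ⟨i', j'⟩
  rw [inner_tmul, hφ, hξ]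
  by_cases h1 : i = i' <;> by_cases h2 : j = j' <;> simp [h1, h2]

lemma tmul_smul_left (c : ℂ) (u : E) (ξ : F) : tmul (c • u) ξ = c • tmul u ξ := by
  rw [← tmulRight_apply, map_smul, tmulRight_apply]

lemma tmul_add_left (u u' : E) (ξ : F) : tmul (u + u') ξ = tmul u ξ + tmul u' ξ := by
  simp only [← tmulRight_apply, map_add]

variable [CompleteSpace F]

open ContinuousLinearMap (adjoint)

/-- The operator `A(u, v)` on `F`, where `⟨ξ₁, A(u, v) ξ₂⟩ = ⟨u ⊗ ξ₁, A (v ⊗ ξ₂)⟩`. -/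
def slice (A : HTensor E F →L[ℂ] HTensor E F) (u v : E) : F →L[ℂ] F :=
  adjoint (tmulLeft F u) ∘L A ∘L tmulLeft F v

lemma inner_slice (A : HTensor E F →L[ℂ] HTensor E F) (u v : E) (ξ₁ ξ₂ : F) :
    ⟪ξ₁, slice A u v ξ₂⟫_ℂ = ⟪tmul u ξ₁, A (tmul v ξ₂)⟫_ℂ := by
  simp [slice, ContinuousLinearMap.adjoint_inner_right]

variable (F) in
/-- A fixed orthonormal basis of `F`. -/
def onb : HilbertBasis (exists_hilbertBasis ℂ F).choose ℂ F :=
  (exists_hilbertBasis ℂ F).choose_spec.choose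

lemma ptrace_sum_le (B : TraceClass (HTensor E F)) {n : ℕ} {φ ψ : Fin n → E}
    (hφ : Orthonormal ℂ φ) (hψ : Orthonormal ℂ ψ)
    (s : Finset (exists_hilbertBasis ℂ F).choose) :
    ∑ k, ∑ j ∈ s, ‖⟪tmul (φ k) (onb F j), TraceClass.toOp _ B (tmul (ψ k) (onb F j))⟫_ℂ‖ ≤ ‖B‖ := by
  have hξ : Orthonormal ℂ (fun j : s => onb F j) :=
    (onb F).orthonormal.comp _ Subtype.val_injective
  refine le_trans (le_of_eq ?_) (B.sum_le_norm (orthonormal_tmul hφ hξ) (orthonormal_tmul hψ hξ))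
  rw [Fintype.sum_prod_type]
  refine Finset.sum_congr rfl fun k _ => ?_
  rw [← Finset.sum_coe_sort]

lemma ptrace_bound (B : TraceClass (HTensor E F)) (u v : E)
    (s : Finset (exists_hilbertBasis ℂ F).choose) :
    ∑ j ∈ s, ‖⟪tmul u (onb F j), TraceClass.toOp _ B (tmul v (onb F j))⟫_ℂ‖
      ≤ ‖B‖ * ‖u‖ * ‖v‖ := by
  have h0 : ∀ ξ : F, tmul (0 : E) ξ = 0 := fun ξ => by rw [← tmulRight_apply, map_zero]
  by_cases hu : u = 0
  · simp [hu, h0]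
  by_cases hv : v = 0
  · simp [hv, h0]
  have h := ptrace_sum_le B (TraceClass.orthonormal_normalize hu)
    (TraceClass.orthonormal_normalize hv) s
  have hu' : 0 < ‖u‖ := norm_pos_iff.2 hu
  have hv' : 0 < ‖v‖ := norm_pos_iff.2 hv
  simp only [Finset.univ_unique, Finset.sum_singleton, tmul_smul_left, map_smul, inner_smul_left,
    inner_smul_right, norm_mul, norm_inv, RCLike.norm_conj, Complex.norm_real, norm_norm] at h
  simp only [← Finset.mul_sum] at h
  rw [← mul_assoc, ← mul_inv, inv_mul_le_iff₀ (by positivity)] at h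
  linarith [h]

lemma ptrace_summable (B : TraceClass (HTensor E F)) (u v : E) :
    Summable fun j => ⟪tmul u (onb F j), TraceClass.toOp _ B (tmul v (onb F j))⟫_ℂ :=
  Summable.of_norm (summable_of_sum_le (fun _ => norm_nonneg _) (ptrace_bound B u v))

/-- The sesquilinear form `(u, v) ↦ ∑ⱼ ⟨u ⊗ ξⱼ, B (v ⊗ ξⱼ)⟩`. -/
def ptraceForm (B : TraceClass (HTensor E F)) : E →L⋆[ℂ] E →L[ℂ] ℂ :=
  LinearMap.mkContinuous₂
    (LinearMap.mk₂'ₛₗ (starRingEnd ℂ) (RingHom.id ℂ)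
      (fun u v => ∑' j, ⟪tmul u (onb F j), TraceClass.toOp _ B (tmul v (onb F j))⟫_ℂ)
      (fun u u' v => by
        rw [← (ptrace_summable B u v).tsum_add (ptrace_summable B u' v)]
        simp only [tmul_add_left, inner_add_left])
      (fun c u v => by
        rw [smul_eq_mul, ← tsum_mul_left]
        simp only [tmul_smul_left, inner_smul_left])
      (fun u v v' => by
        rw [← (ptrace_summable B u v).tsum_add (ptrace_summable B u v')]
        simp only [tmul_add_left, map_add, inner_add_right])
      (fun c u v => by
        rw [RingHom.id_apply, smul_eq_mul, ← tsum_mul_left]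
        simp only [tmul_smul_left, map_smul, inner_smul_right]))
    ‖B‖ fun u v => by
      refine tsum_of_norm_bounded (summable_of_sum_le (fun _ => norm_nonneg _)
        (ptrace_bound B u v)).hasSum (fun _ => le_rfl) |>.trans ?_
      exact Summable.tsum_le_of_sum_le (summable_of_sum_le (fun _ => norm_nonneg _)
        (ptrace_bound B u v)) (ptrace_bound B u v)

variable [CompleteSpace E]

/-- The partial trace over `F` of `B`, as a bounded operator. -/
def ptraceOp (B : TraceClass (HTensor E F)) : E →L[ℂ] E :=
  adjoint (InnerProductSpace.continuousLinearMapOfBilin (ptraceForm B))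

lemma inner_ptraceOp (B : TraceClass (HTensor E F)) (u v : E) :
    ⟪u, ptraceOp B v⟫_ℂ =
      ∑' j, ⟪tmul u (onb F j), TraceClass.toOp _ B (tmul v (onb F j))⟫_ℂ := by
  rw [ptraceOp, ContinuousLinearMap.adjoint_inner_right,
    InnerProductSpace.continuousLinearMapOfBilin_apply]
  rfl

lemma sum_ptraceOp_le (B : TraceClass (HTensor E F)) {n : ℕ} {φ ψ : Fin n → E}
    (hφ : Orthonormal ℂ φ) (hψ : Orthonormal ℂ ψ) :
    ∑ k, ‖⟪φ k, ptraceOp B (ψ k)⟫_ℂ‖ ≤ ‖B‖ := by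
  have hs : ∀ k, Summable fun j =>
      ‖⟪tmul (φ k) (onb F j), TraceClass.toOp _ B (tmul (ψ k) (onb F j))⟫_ℂ‖ := fun k =>
    summable_of_sum_le (fun _ => norm_nonneg _) (ptrace_bound B (φ k) (ψ k))
  calc ∑ k, ‖⟪φ k, ptraceOp B (ψ k)⟫_ℂ‖
      ≤ ∑ k, ∑' j, ‖⟪tmul (φ k) (onb F j),
          TraceClass.toOp _ B (tmul (ψ k) (onb F j))⟫_ℂ‖ := by
        refine Finset.sum_le_sum fun k _ => ?_
        rw [inner_ptraceOp]
        exact norm_tsum_le_tsum_norm (hs k)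
    _ = ∑' j, ∑ k, ‖⟪tmul (φ k) (onb F j),
          TraceClass.toOp _ B (tmul (ψ k) (onb F j))⟫_ℂ‖ :=
        (Summable.tsum_finsetSum fun k _ => hs k).symm
    _ ≤ ‖B‖ := by
        refine Summable.tsum_le_of_sum_le (summable_sum fun k _ => hs k) fun s => ?_
        rw [Finset.sum_comm]
        exact ptrace_sum_le B hφ hψ s

/-- The partial trace `Tr_F`: `⟨u, Tr_F(B) v⟩ = ∑ⱼ ⟨u ⊗ ξⱼ, B (v ⊗ ξⱼ)⟩`. -/
def ptrace : TraceClass (HTensor E F) →L[ℂ] TraceClass E :=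
  LinearMap.mkContinuous
    { toFun := fun B => TraceClass.mk (ptraceOp B)
        (ne_top_of_le_ne_top ENNReal.ofReal_ne_top
          (traceNorm_le fun _ _ _ hφ hψ => sum_ptraceOp_le B hφ hψ))
      map_add' := fun B C => TraceClass.toOp_injective (by
        ext v
        refine ext_inner_left ℂ fun u => ?_
        simp only [map_add, TraceClass.toOp_mk, add_apply, inner_add_right, inner_ptraceOp]
        exact (ptrace_summable B u v).tsum_add (ptrace_summable C u v))
      map_smul' := fun c B => TraceClass.toOp_injective (by
        ext v
        refine ext_inner_left ℂ fun u => ?_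
        simp only [map_smul, TraceClass.toOp_mk, smul_apply, inner_smul_right,
          inner_ptraceOp, RingHom.id_apply]
        exact tsum_mul_left) }
    1 fun B => by
      rw [one_mul]
      exact toReal_traceNorm_le (norm_nonneg B) fun _ _ _ hφ hψ => sum_ptraceOp_le B hφ hψ

@[simp] lemma toOp_ptrace (B : TraceClass (HTensor E F)) :
    TraceClass.toOp E (ptrace B) = ptraceOp B := rfl

end Tensor

/-! ### Generators of one-parameter families -/

section Generator

variable {X : Type*} [NormedAddCommGroup X] [NormedSpace ℂ X]

/-- `y` is the derivative at `0+` of `t ↦ T t x`. -/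
def HasGenerator (T : ℝ → X →L[ℂ] X) (x y : X) : Prop :=
  Tendsto (fun t : ℝ => (t : ℂ)⁻¹ • (T t x - x)) (𝓝[>] 0) (𝓝 y)

lemma HasGenerator.add {T : ℝ → X →L[ℂ] X} {x y x' y' : X} (h : HasGenerator T x y)
    (h' : HasGenerator T x' y') : HasGenerator T (x + x') (y + y') :=
  (Tendsto.add h h').congr fun t => by rw [map_add, ← smul_add]; congr 1; abel

lemma HasGenerator.smul {T : ℝ → X →L[ℂ] X} {x y : X} (c : ℂ) (h : HasGenerator T x y) :
    HasGenerator T (c • x) (c • y) :=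
  (Tendsto.const_smul h c).congr fun t => by rw [map_smul, ← smul_sub, smul_comm]

/-- The infinitesimal generator of `T`: its domain consists of the `x` for which
`t⁻¹ (T t x - x)` converges as `t → 0+`, and its value at `x` is the limit. -/
def generator (T : ℝ → X →L[ℂ] X) : X →ₗ.[ℂ] X where
  domain :=
    { carrier := {x | ∃ y, HasGenerator T x y}
      zero_mem' := ⟨0, by simp [HasGenerator]⟩
      add_mem' := fun ⟨_, h⟩ ⟨_, h'⟩ => ⟨_, h.add h'⟩
      smul_mem' := fun c _ ⟨_, h⟩ => ⟨_, h.smul c⟩ }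
  toFun :=
    { toFun := fun x => x.2.choose
      map_add' := fun x x' =>
        tendsto_nhds_unique (x + x').2.choose_spec (x.2.choose_spec.add x'.2.choose_spec)
      map_smul' := fun c x =>
        tendsto_nhds_unique (c • x).2.choose_spec (x.2.choose_spec.smul c) }

end Generator

/-! ### Unitary processes with stationary and independent increments -/

section Increments

variable {h H : Type*} [NormedAddCommGroup h] [InnerProductSpace ℂ h] [CompleteSpace h]
variable [NormedAddCommGroup H] [InnerProductSpace ℂ H] [CompleteSpace H]

open ContinuousLinearMap (adjoint)

/-- `A` if `ε` is `false` (standing for `0`), and `A*` if `ε` is `true` (standing for `1`). -/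
def starIf (ε : Bool) (A : HTensor h H →L[ℂ] HTensor h H) : HTensor h H →L[ℂ] HTensor h H :=
  if ε then adjoint A else A

/-- The product `U_{a₁,b₁}^{(ε₁)}(u₁, v₁) ⋯ U_{aₙ,bₙ}^{(εₙ)}(uₙ, vₙ)`, an operator on `H`. -/
def incrementProd (U : ℝ → ℝ → HTensor h H →L[ℂ] HTensor h H) {n : ℕ} (a b : Fin n → ℝ)
    (ε : Fin n → Bool) (u v : Fin n → h) : H →L[ℂ] H :=
  (List.ofFn fun k => slice (starIf (ε k) (U (a k) (b k))) (u k) (v k)).prod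

/-- The intervals `[a₁, b₁], …, [aₙ, bₙ]` lie in `[α, β]` and are listed in temporal order:
of two of them, either they are the same interval, or the earlier one ends before the later
one starts. -/
def OrderedIn (α β : ℝ) {n : ℕ} (a b : Fin n → ℝ) : Prop :=
  (∀ k, α ≤ a k ∧ a k ≤ b k ∧ b k ≤ β) ∧
    ∀ i j, i < j → (a i = a j ∧ b i = b j) ∨ b i ≤ a j

/-- A family of unitary operators `U_{s,t}`, `0 ≤ s ≤ t`, on `h ⊗ H` that is an evolution with
independent and stationary increments with respect to the unit vector `Ω`. -/
structure UnitaryIncrementProcess (U : ℝ → ℝ → HTensor h H →L[ℂ] HTensor h H) (Ω : H) :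
    Prop where
  norm_vacuum : ‖Ω‖ = 1
  unitary : ∀ s t, 0 ≤ s → s ≤ t → U s t ∈ unitary (HTensor h H →L[ℂ] HTensor h H)
  evolution : ∀ r s t, 0 ≤ r → r ≤ s → s ≤ t → U r s ∘L U s t = U r t
  commute : ∀ s₁ t₁ s₂ t₂, 0 ≤ s₁ → s₁ ≤ t₁ → 0 ≤ s₂ → s₂ ≤ t₂ →
    Disjoint (Set.Ico s₁ t₁) (Set.Ico s₂ t₂) → ∀ u₁ v₁ u₂ v₂ : h,
      Commute (slice (U s₁ t₁) u₁ v₁) (slice (U s₂ t₂) u₂ v₂) ∧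
      Commute (slice (U s₁ t₁) u₁ v₁) (slice (adjoint (U s₂ t₂)) u₂ v₂)
  independent : ∀ s₁ t₁ s₂ t₂, 0 ≤ s₁ → s₁ ≤ t₁ → 0 ≤ s₂ → s₂ ≤ t₂ →
    Disjoint (Set.Ico s₁ t₁) (Set.Ico s₂ t₂) →
    ∀ (n m : ℕ) (a b : Fin n → ℝ) (q r : Fin m → ℝ) (ε : Fin n → Bool) (ε' : Fin m → Bool)
      (u v : Fin n → h) (p w : Fin m → h), OrderedIn s₁ t₁ a b → OrderedIn s₂ t₂ q r →
      ⟪Ω, incrementProd U a b ε u v (incrementProd U q r ε' p w Ω)⟫_ℂ =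
        ⟪Ω, incrementProd U a b ε u v Ω⟫_ℂ * ⟪Ω, incrementProd U q r ε' p w Ω⟫_ℂ
  stationary : ∀ s t, 0 ≤ s → s ≤ t → ∀ (n : ℕ) (ε : Fin n → Bool) (u v : Fin n → h),
    ⟪Ω, incrementProd U (fun _ => s) (fun _ => t) ε u v Ω⟫_ℂ =
      ⟪Ω, incrementProd U (fun _ => 0) (fun _ => t - s) ε u v Ω⟫_ℂ

/-- Weak continuity: `⟨Ω, (U_t - 1)(u, v) Ω⟩ → 0` as `t → 0`, where `U_t = U_{0,t}`. -/
def WeaklyContinuous (U : ℝ → ℝ → HTensor h H →L[ℂ] HTensor h H) (Ω : H) : Prop :=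
  ∀ u v : h, Tendsto (fun t : ℝ => ⟪Ω, slice (U 0 t - 1) u v Ω⟫_ℂ) (𝓝[>] 0) (𝓝 0)

/-- Gaussian condition: third order moments of the increments are `o(t)` as `t → 0`. -/
def Gaussian (U : ℝ → ℝ → HTensor h H →L[ℂ] HTensor h H) (Ω : H) : Prop :=
  ∀ (u₁ v₁ u₂ v₂ u₃ v₃ : h) (ε₁ ε₂ ε₃ : Bool),
    Tendsto (fun t : ℝ => (t : ℂ)⁻¹ * ⟪Ω, slice (starIf ε₁ (U 0 t) - 1) u₁ v₁
      (slice (starIf ε₂ (U 0 t) - 1) u₂ v₂ (slice (starIf ε₃ (U 0 t) - 1) u₃ v₃ Ω))⟫_ℂ)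
      (𝓝[>] 0) (𝓝 0)

/-- The expectation semigroup `T_t` on `h`: `⟨u, T_t v⟩ = ⟨Ω, U_t(u, v) Ω⟩`. -/
def expSemigroup (U : ℝ → ℝ → HTensor h H →L[ℂ] HTensor h H) (Ω : H) (t : ℝ) : h →L[ℂ] h :=
  adjoint (tmulRight h Ω) ∘L U 0 t ∘L tmulRight h Ω

lemma inner_expSemigroup (U : ℝ → ℝ → HTensor h H →L[ℂ] HTensor h H) (Ω : H) (t : ℝ) (u v : h) :
    ⟪u, expSemigroup U Ω t v⟫_ℂ = ⟪Ω, slice (U 0 t) u v Ω⟫_ℂ := by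
  rw [inner_slice]
  simp [expSemigroup, ContinuousLinearMap.adjoint_inner_right]

/-- The map `ρ ↦ ρ ⊗ |Ω⟩⟨Ω|` on trace class operators. -/
def ampliate (Ω : H) : TraceClass h →L[ℂ] TraceClass (HTensor h H) :=
  TraceClass.sandwich (tmulRight h Ω)

lemma toOp_ampliate (Ω : H) (ρ : TraceClass h) (v : h) (ξ : H) :
    TraceClass.toOp _ (ampliate Ω ρ) (tmul v ξ) =
      tmul (TraceClass.toOp h ρ v) (⟪Ω, ξ⟫_ℂ • Ω) := by
  have : adjoint (tmulRight h Ω) (tmul v ξ) = ⟪Ω, ξ⟫_ℂ • v :=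
    ext_inner_left ℂ fun u => by
      simp [ContinuousLinearMap.adjoint_inner_right, inner_smul_right, mul_comm]
  rw [ampliate, TraceClass.toOp_sandwich]
  simp only [ContinuousLinearMap.comp_apply, this, map_smul, tmulRight_apply]
  rw [← tmulLeft_apply _ (⟪Ω, ξ⟫_ℂ • Ω), map_smul, tmulLeft_apply]

/-- The semigroup `Z_t ρ = Tr_H[U_t (ρ ⊗ |Ω⟩⟨Ω|) U_t*]` on the trace class operators. -/
def semigroupZ (U : ℝ → ℝ → HTensor h H →L[ℂ] HTensor h H) (Ω : H) (t : ℝ) :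
    TraceClass h →L[ℂ] TraceClass h :=
  ptrace ∘L TraceClass.sandwich (U 0 t) ∘L ampliate Ω

/-- The semigroup `F_t ρ = Tr_H[U_t* (ρ ⊗ |Ω⟩⟨Ω|) U_t]` on the trace class operators. -/
def semigroupF (U : ℝ → ℝ → HTensor h H →L[ℂ] HTensor h H) (Ω : H) (t : ℝ) :
    TraceClass h →L[ℂ] TraceClass h :=
  ptrace ∘L TraceClass.sandwich (adjoint (U 0 t)) ∘L ampliate Ω

/-- The generator `G` of `T_t`. -/
def genG (U : ℝ → ℝ → HTensor h H →L[ℂ] HTensor h H) (Ω : H) : h →ₗ.[ℂ] h :=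
  generator (expSemigroup U Ω)

/-- The span of the operators `|u⟩⟨v|` with `u, v ∈ 𝒟`. -/
def rankOneSpan (𝒟 : Submodule ℂ h) : Submodule ℂ (TraceClass h) :=
  Submodule.span ℂ {ρ | ∃ u ∈ 𝒟, ∃ v ∈ 𝒟, ρ = TraceClass.rankOne u v}

/-- `𝒟` is a dense subspace of `D(G) ∩ D(G*)` and a core for `G`, and the span of the operators
`|u⟩⟨v|`, `u, v ∈ 𝒟`, is a core for the generators of both `Z_t` and `F_t`. -/
structure CoreAssumption (U : ℝ → ℝ → HTensor h H →L[ℂ] HTensor h H) (Ω : H)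
    (𝒟 : Submodule ℂ h) : Prop where
  dense : Dense (𝒟 : Set h)
  le_domain : 𝒟 ≤ (genG U Ω).domain
  le_adjoint_domain : 𝒟 ≤ (genG U Ω).adjoint.domain
  core_G : (genG U Ω).HasCore 𝒟
  core_Z : (generator (semigroupZ U Ω)).HasCore (rankOneSpan 𝒟)
  core_F : (generator (semigroupF U Ω)).HasCore (rankOneSpan 𝒟)

/-! ### The noise space and the coefficients -/

/-- The index set of the noise space: non-empty words of triples `(u, v, ε)`, with `u ∈ h`,
`v ∈ 𝒟` and `ε ∈ {0, 1}`. -/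
abbrev Word (𝒟 : Submodule ℂ h) : Type _ := {l : List (h × 𝒟 × Bool) // l ≠ []}

/-- The vector `(U_t^{(ε)} - 1)(u, v) Ω = (∏ᵢ U_t^{(εᵢ)}(uᵢ, vᵢ) - ∏ᵢ ⟨uᵢ, vᵢ⟩) Ω` of a word. -/
def wordVec (U : ℝ → ℝ → HTensor h H →L[ℂ] HTensor h H) (Ω : H) {𝒟 : Submodule ℂ h} (t : ℝ)
    (l : Word 𝒟) : H :=
  (l.1.map fun x => slice (starIf x.2.2 (U 0 t)) x.1 (x.2.1 : h)).prod Ω -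
    (l.1.map fun x => ⟪x.1, (x.2.1 : h)⟫_ℂ).prod • Ω

/-- The kernel `K(l, l') = lim_{t → 0} t⁻¹ ⟨(U_t^{(ε)} - 1)(u, v) Ω, (U_t^{(ε')} - 1)(p, w) Ω⟩`. -/
def noiseKernel (U : ℝ → ℝ → HTensor h H →L[ℂ] HTensor h H) (Ω : H) {𝒟 : Submodule ℂ h}
    (l l' : Word 𝒟) : ℂ :=
  limUnder (𝓝[>] (0 : ℝ)) fun t : ℝ => (t : ℂ)⁻¹ * ⟪wordVec U Ω t l, wordVec U Ω t l'⟫_ℂ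

open Classical in
/-- The kernel `K`, its entries being regarded as operators on `ℂ`. It is positive semidefinite
for the processes considered here; the value `0` is a convention for the case that it is not. -/
def noiseMatrix (U : ℝ → ℝ → HTensor h H →L[ℂ] HTensor h H) (Ω : H) (𝒟 : Submodule ℂ h) :
    Matrix (Word 𝒟) (Word 𝒟) (ℂ →L[ℂ] ℂ) :=
  if (Matrix.of fun l l' : Word 𝒟 =>
      noiseKernel U Ω l l' • (1 : ℂ →L[ℂ] ℂ)).PosSemidef then
    Matrix.of fun l l' : Word 𝒟 => noiseKernel U Ω l l' • (1 : ℂ →L[ℂ] ℂ)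
  else 0

instance (U : ℝ → ℝ → HTensor h H →L[ℂ] HTensor h H) (Ω : H) (𝒟 : Submodule ℂ h) :
    Fact (noiseMatrix U Ω 𝒟).PosSemidef :=
  ⟨by
    unfold noiseMatrix
    split_ifs with hK
    · exact hK
    · exact Matrix.PosSemidef.zero⟩

/-- The noise space `k`: the Hilbert space of the positive definite kernel `K`. -/
abbrev NoiseSpace (U : ℝ → ℝ → HTensor h H →L[ℂ] HTensor h H) (Ω : H) (𝒟 : Submodule ℂ h) :
    Type _ :=
  RKHS.OfKernel (noiseMatrix U Ω 𝒟)

/-- The embedding `η` of the words in the noise space: `⟨η(l), η(l')⟩ = K(l, l')`, and the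
vectors `η(l)` are total. -/
def noiseEmb (U : ℝ → ℝ → HTensor h H →L[ℂ] HTensor h H) (Ω : H) {𝒟 : Submodule ℂ h}
    (l : Word 𝒟) : NoiseSpace U Ω 𝒟 :=
  RKHS.kerFun (NoiseSpace U Ω 𝒟) l 1

lemma inner_noiseEmb (U : ℝ → ℝ → HTensor h H →L[ℂ] HTensor h H) (Ω : H) {𝒟 : Submodule ℂ h}
    (l l' : Word 𝒟) :
    ⟪noiseEmb U Ω l, noiseEmb U Ω l'⟫_ℂ = noiseMatrix U Ω 𝒟 l l' 1 := by
  rw [noiseEmb, noiseEmb, RKHS.kerFun_inner, RKHS.kerFun_apply, RKHS.OfKernel.kernel_ofKernel]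
  simp

/-- The vector `η(u, v) = η(u, v, 0)`. -/
def eta (U : ℝ → ℝ → HTensor h H →L[ℂ] HTensor h H) (Ω : H) {𝒟 : Submodule ℂ h} (u : h) (v : 𝒟) :
    NoiseSpace U Ω 𝒟 :=
  noiseEmb U Ω ⟨[(u, v, false)], by simp⟩

open Classical in
/-- The coefficients `L_j : 𝒟 → h`, for an orthonormal basis `(e_j)` of the noise space:
`L_j v` is the vector with `⟨u, L_j v⟩ = ⟨e_j, η(u, v)⟩` for all `u`. (The value `0` is a convention
for the case that there is no such vector.) -/
def coeffL {U : ℝ → ℝ → HTensor h H →L[ℂ] HTensor h H} {Ω : H} {𝒟 : Submodule ℂ h} {ι : Type*}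
    (e : HilbertBasis ι ℂ (NoiseSpace U Ω 𝒟)) (j : ι) (v : 𝒟) : h :=
  if hx : ∃ x : h, ∀ u : h, ⟪u, x⟫_ℂ = ⟪e j, eta U Ω u v⟫_ℂ then hx.choose else 0

/-- The restriction of a partially defined operator to a subspace `𝒟` of its domain. -/
def restrictTo {𝒟 : Submodule ℂ h} (A : h →ₗ.[ℂ] h) (hA : 𝒟 ≤ A.domain) (v : 𝒟) : h :=
  A ⟨v, hA v.2⟩

/-- The Feller set: positive bounded operators `x` with
`⟨v, x A w⟩ + ⟨A v, x w⟩ + ∑ⱼ ⟨L_j v, x L_j w⟩ = lam ⟨v, x w⟩` for all `v, w ∈ 𝒟`. -/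
def fellerSet {𝒟 : Submodule ℂ h} {ι : Type*} (A : 𝒟 → h) (L : ι → 𝒟 → h) (lam : ℝ) :
    Set (h →L[ℂ] h) :=
  {x | x.IsPositive ∧ ∀ v w : 𝒟,
    (Summable fun j => ⟪L j v, x (L j w)⟫_ℂ) ∧
    ⟪(v : h), x (A w)⟫_ℂ + ⟪A v, x w⟫_ℂ + ∑' j, ⟪L j v, x (L j w)⟫_ℂ =
      (lam : ℂ) * ⟪(v : h), x w⟫_ℂ}

end Increments

end QUnitary

end

noncomputable section

set_option linter.unusedSectionVars false

namespace QUnitary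

open ContinuousLinearMap (adjoint)

/-! ### Rank one expansions in the trace norm and the pairing `Tr(xρ)` -/

section TraceFunctional

variable {E : Type*} [NormedAddCommGroup E] [InnerProductSpace ℂ E]

namespace TraceClass

/-! An element x of the Feller set gives an eigenfunctional of a generator. Put φ(ρ) = Tr(xρ). On
|w⟩⟨v| with w, v ∈ 𝒟 the generator of Z is |Gw⟩⟨v| + |w⟩⟨Gv| + ∑ⱼ |Lⱼw⟩⟨Lⱼv|, so the defining
identity of the Feller set reads φ(ℒρ) = λφ(ρ) there. These operators span a core and φ is bounded
in the trace norm, so the relation holds on all of D(ℒ) (`fellerSet_eq_zero`). Then e^{-λt} φ(Z_t ρ)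
has zero derivative, and contractivity of Z_t forces it to 0 as t → ∞; hence φ(ρ) = 0
(`ContractiveOrbit.eq_zero_of_eigen`), and density of 𝒟 gives x = 0. Any λ > 0 will do. The other
Feller set is treated in the same way with F and G*.

The work is in the two generator formulas. Expanding Tr_H[(U_t - 1)(|w⟩⟨v| ⊗ |Ω⟩⟨Ω|)(U_t - 1)*]
separates the drift from a noise part (`channel_sub_one_rankOne`, `CoreAssumption.noiseOp`). The
entries of the noise part are the inner products of the noise space (`inner_eta`), and Parseval
there splits it into the Lⱼ, convergently in the trace norm (`hasSum_rankOne_coeffL`).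

For F the same Lⱼ must appear. Unitarity gives (U - 1) + (U* - 1) = -(U* - 1)(U - 1). Increments on
Ω are O(√t), while condition C makes products of two of them o(√t), so U* - 1 may be replaced by -(U
- 1) in the limit (`isLittleO_slice_add_slice_adjoint`). The product on the right involves an
infinite sum over a basis of h; its tail is controlled because the noise limit holds in the trace
norm. The drift G* comes from weak differentiability of T_t* on D(G*)
(`tendsto_inner_adjoint_generator`).

The semigroup laws for Z and F are proved on the trace norm closure of the finite rank operators.
There identities of channels need checking only on rank one operators, whose images have second
vacuum moments as entries, and independence and stationarity apply. -/

lemma ext_inner {ρ σ : TraceClass E}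
    (h : ∀ u p : E, ⟪u, toOp E ρ p⟫_ℂ = ⟪u, toOp E σ p⟫_ℂ) : ρ = σ :=
  toOp_injective (ContinuousLinearMap.ext fun p => ext_inner_left ℂ fun u => h u p)

/-- The matrix entry `ρ ↦ ⟨u, ρ p⟩` as a continuous functional in the trace norm. -/
def entry (u p : E) : TraceClass E →L[ℂ] ℂ :=
  LinearMap.mkContinuous
    { toFun := fun ρ => ⟪u, toOp E ρ p⟫_ℂ
      map_add' := fun ρ σ => by simp
      map_smul' := fun c ρ => by simp }
    (‖u‖ * ‖p‖) fun ρ => ρ.norm_inner_le u p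

@[simp] lemma entry_apply (u p : E) (ρ : TraceClass E) : entry u p ρ = ⟪u, toOp E ρ p⟫_ℂ := rfl

lemma norm_le {ρ : TraceClass E} {C : ℝ} (hC : 0 ≤ C)
    (h : ∀ (n : ℕ) (φ ψ : Fin n → E), Orthonormal ℂ φ → Orthonormal ℂ ψ →
      ∑ k, ‖⟪φ k, toOp E ρ (ψ k)⟫_ℂ‖ ≤ C) : ‖ρ‖ ≤ C :=
  toReal_traceNorm_le hC h

lemma norm_rankOne_le (a b : E) : ‖rankOne a b‖ ≤ ‖a‖ * ‖b‖ := by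
  refine norm_le (by positivity) fun n φ ψ hφ hψ => ?_
  refine le_trans (Finset.sum_le_sum fun k _ => ?_) (sum_norm_inner_mul_le hφ hψ a b)
  rw [toOp_rankOne, inner_smul_right, norm_mul, norm_inner_symm b, mul_comm]

/-- `|a⟩⟨b|` as a continuous sesquilinear function of `a` and `b`. -/
def rankOneL : E →L[ℂ] E →L⋆[ℂ] TraceClass E :=
  LinearMap.mkContinuous₂
    (LinearMap.mk₂'ₛₗ (RingHom.id ℂ) (starRingEnd ℂ) (fun a b => rankOne a b)
      (fun a a' b => ext_inner fun u p => by simp)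
      (fun c a b => ext_inner fun u p => by simp; ring)
      (fun a b b' => ext_inner fun u p => by simp [add_smul])
      (fun c a b => ext_inner fun u p => by simp; ring))
    1 fun a b => by simpa using norm_rankOne_le a b

@[simp] lemma rankOneL_apply (a b : E) : rankOneL a b = rankOne a b := rfl

lemma tendsto_rankOne_left {α : Type*} {l : Filter α} {f : α → E} {a : E} (hf : Tendsto f l (𝓝 a))
    (b : E) : Tendsto (fun t => rankOne (f t) b) l (𝓝 (rankOne a b)) :=
  (((rankOneL (E := E)).flip b).continuous.tendsto a).comp hf

lemma tendsto_rankOne_right {α : Type*} {l : Filter α} {f : α → E} {b : E}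
    (hf : Tendsto f l (𝓝 b)) (a : E) :
    Tendsto (fun t => rankOne a (f t)) l (𝓝 (rankOne a b)) :=
  ((rankOneL (E := E) a).continuous.tendsto b).comp hf

/-- An absolutely convergent expansion of the entries into rank one terms converges in the trace
norm. -/
lemma hasSum_rankOne {ι : Type*} {a b : ι → E} {ρ : TraceClass E}
    (hs : Summable fun j => ‖a j‖ * ‖b j‖)
    (h : ∀ u p : E, ⟪u, toOp E ρ p⟫_ℂ = ∑' j, ⟪u, a j⟫_ℂ * ⟪b j, p⟫_ℂ) :
    HasSum (fun j => rankOne (a j) (b j)) ρ := by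
  classical
  have hs' : ∀ u p : E, Summable fun j => ⟪u, a j⟫_ℂ * ⟪b j, p⟫_ℂ := fun u p =>
    Summable.of_norm_bounded (hs.mul_left (‖u‖ * ‖p‖)) fun j => by
      rw [norm_mul]
      calc ‖⟪u, a j⟫_ℂ‖ * ‖⟪b j, p⟫_ℂ‖ ≤ (‖u‖ * ‖a j‖) * (‖b j‖ * ‖p‖) := by
            gcongr <;> exact norm_inner_le_norm _ _
        _ = _ := by ring
  -- The remainder has as entries the tail of the expansion; testing it on two orthonormal systems
  -- and applying Bessel term by term bounds its trace norm by the tail of `hs`.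
  have key : ∀ s : Finset ι, ‖(∑ j ∈ s, rankOne (a j) (b j)) - ρ‖
      ≤ ∑' j : {j // j ∉ s}, ‖a j‖ * ‖b j‖ := fun s => by
    rw [norm_sub_rev]
    have hsub : Summable fun j : {j // j ∉ s} => ‖a j‖ * ‖b j‖ := hs.subtype _
    refine norm_le (tsum_nonneg fun j => by positivity) fun n φ ψ hφ hψ => ?_
    have h1 : ∀ k, ⟪φ k, toOp E (ρ - ∑ j ∈ s, rankOne (a j) (b j)) (ψ k)⟫_ℂ
        = ∑' j : {j // j ∉ s}, ⟪φ k, a j⟫_ℂ * ⟪b j, ψ k⟫_ℂ := fun k => by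
      have h2 := (hs' (φ k) (ψ k)).sum_add_tsum_subtype_compl s
      rw [← entry_apply, map_sub, map_sum]
      simp only [entry_apply, toOp_rankOne, inner_smul_right, h]
      rw [← h2]
      simp only [mul_comm ⟪b _, ψ k⟫_ℂ]
      ring
    have hs2 : ∀ k, Summable fun j : {j // j ∉ s} => ‖⟪φ k, a j⟫_ℂ‖ * ‖⟪b j, ψ k⟫_ℂ‖ := fun k => by
      simp only [← norm_mul]
      exact (hs' (φ k) (ψ k)).norm.subtype {j | j ∉ s}
    calc ∑ k, ‖⟪φ k, toOp E (ρ - ∑ j ∈ s, rankOne (a j) (b j)) (ψ k)⟫_ℂ‖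
        ≤ ∑ k, ∑' j : {j // j ∉ s}, ‖⟪φ k, a j⟫_ℂ‖ * ‖⟪b j, ψ k⟫_ℂ‖ := by
          refine Finset.sum_le_sum fun k _ => ?_
          rw [h1]
          have := hs2 k
          simp only [← norm_mul] at this ⊢
          exact norm_tsum_le_tsum_norm this
      _ = ∑' j : {j // j ∉ s}, ∑ k, ‖⟪φ k, a j⟫_ℂ‖ * ‖⟪b j, ψ k⟫_ℂ‖ :=
          (Summable.tsum_finsetSum fun k _ => hs2 k).symm
      _ ≤ _ := by
          refine Summable.tsum_le_tsum (fun j => ?_) (summable_sum fun k _ => hs2 k) hsub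
          simp only [norm_inner_symm (b _)]
          exact sum_norm_inner_mul_le hφ hψ _ _
  rw [HasSum, SummationFilter.unconditional_filter, tendsto_iff_norm_sub_tendsto_zero]
  exact squeeze_zero (fun _ => norm_nonneg _) key
    (tendsto_tsum_compl_atTop_zero fun j => ‖a j‖ * ‖b j‖)

variable [CompleteSpace E]

/-- Only the compression of ρ to the finite dimensional span of the vectors involved is seen. Its
singular value decomposition has total weight at most ‖ρ‖, and Bessel bounds each rank one term.
This is the estimate |Tr(xρ)| ≤ ‖x‖‖ρ‖ on finite systems. -/
lemma sum_inner_comp_le (x : E →L[ℂ] E) (ρ : TraceClass E) {κ : Type*} [Fintype κ] {φ ψ : κ → E}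
    (hφ : Orthonormal ℂ φ) (hψ : Orthonormal ℂ ψ) :
    ∑ k, ‖⟪adjoint x (φ k), toOp E ρ (ψ k)⟫_ℂ‖ ≤ ‖x‖ * ‖ρ‖ := by
  set S : Submodule ℂ E := Submodule.span ℂ
    (Set.range (fun k => adjoint x (φ k)) ∪ Set.range ψ) with hS
  have : FiniteDimensional ℂ S :=
    FiniteDimensional.span_of_finite ℂ ((Set.finite_range _).union (Set.finite_range _))
  obtain ⟨m, a, b, hab, hle⟩ := ρ.exists_decomp S
  have hterm : ∀ k, ‖⟪adjoint x (φ k), toOp E ρ (ψ k)⟫_ℂ‖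
      ≤ ∑ i, ‖⟪φ k, x (a i)⟫_ℂ‖ * ‖⟪ψ k, b i⟫_ℂ‖ := fun k => by
    rw [hab _ (Submodule.subset_span (Or.inl ⟨k, rfl⟩)) _
      (Submodule.subset_span (Or.inr ⟨k, rfl⟩))]
    refine (norm_sum_le _ _).trans (Finset.sum_le_sum fun i _ => ?_)
    rw [norm_mul, ContinuousLinearMap.adjoint_inner_left, norm_inner_symm (ψ k)]
  refine (Finset.sum_le_sum fun k _ => hterm k).trans ?_
  rw [Finset.sum_comm]
  calc ∑ i, ∑ k, ‖⟪φ k, x (a i)⟫_ℂ‖ * ‖⟪ψ k, b i⟫_ℂ‖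
      ≤ ∑ i, ‖x‖ * (‖a i‖ * ‖b i‖) := Finset.sum_le_sum fun i _ => by
        refine (sum_norm_inner_mul_le hφ hψ _ _).trans ?_
        rw [← mul_assoc]
        gcongr
        exact x.le_opNorm _
    _ ≤ _ := by
        rw [← Finset.mul_sum]
        gcongr

lemma sum_inner_onb_le (x : E →L[ℂ] E) (ρ : TraceClass E)
    (s : Finset (exists_hilbertBasis ℂ E).choose) :
    ∑ k ∈ s, ‖⟪adjoint x (onb E k), toOp E ρ (onb E k)⟫_ℂ‖ ≤ ‖x‖ * ‖ρ‖ := by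
  have h : Orthonormal ℂ (fun j : s => onb E j) :=
    (onb E).orthonormal.comp _ Subtype.val_injective
  rw [← Finset.sum_coe_sort]
  exact sum_inner_comp_le x ρ h h

lemma summable_inner_onb (x : E →L[ℂ] E) (ρ : TraceClass E) :
    Summable fun k => ⟪adjoint x (onb E k), toOp E ρ (onb E k)⟫_ℂ :=
  Summable.of_norm (summable_of_sum_le (fun _ => norm_nonneg _) (sum_inner_onb_le x ρ))

/-- The functional `ρ ↦ Tr(x ρ)`. -/
def tracePair (x : E →L[ℂ] E) : TraceClass E →L[ℂ] ℂ :=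
  LinearMap.mkContinuous
    { toFun := fun ρ => ∑' k, ⟪adjoint x (onb E k), toOp E ρ (onb E k)⟫_ℂ
      map_add' := fun ρ σ => by
        rw [← (summable_inner_onb x ρ).tsum_add (summable_inner_onb x σ)]
        simp
      map_smul' := fun c ρ => by
        simp only [map_smul, smul_apply, inner_smul_right, RingHom.id_apply,
          smul_eq_mul, tsum_mul_left] }
    ‖x‖ fun ρ => by
      have hs := summable_of_sum_le (fun _ => norm_nonneg _) (sum_inner_onb_le x ρ)
      exact (norm_tsum_le_tsum_norm hs).trans
        (Summable.tsum_le_of_sum_le hs (sum_inner_onb_le x ρ))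

lemma tracePair_apply (x : E →L[ℂ] E) (ρ : TraceClass E) :
    tracePair x ρ = ∑' k, ⟪adjoint x (onb E k), toOp E ρ (onb E k)⟫_ℂ := rfl

@[simp] lemma tracePair_rankOne (x : E →L[ℂ] E) (a b : E) :
    tracePair x (rankOne a b) = ⟪b, x a⟫_ℂ := by
  rw [tracePair_apply, ← (onb E).tsum_inner_mul_inner b (x a)]
  simp only [toOp_rankOne, inner_smul_right, ContinuousLinearMap.adjoint_inner_left]

end TraceClass

end TraceFunctional

/-! ### Expansion of vectors of the tensor product along a basis of the first factor -/

section TensorExpansion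

variable {E F : Type*} [NormedAddCommGroup E] [InnerProductSpace ℂ E]
variable [NormedAddCommGroup F] [InnerProductSpace ℂ F]

lemma tmul_smul_right (c : ℂ) (u : E) (ξ : F) : tmul u (c • ξ) = c • tmul u ξ := by
  rw [← tmulLeft_apply, map_smul, tmulLeft_apply]

lemma norm_sq_eq_of_inner_self {x : E} {r : ℝ} (hr : ⟪x, x⟫_ℂ = (r : ℂ)) : ‖x‖ ^ 2 = r := by
  have := inner_self_eq_norm_sq (𝕜 := ℂ) x
  rw [hr] at this
  simpa using this.symm

lemma norm_tmul (u : E) (ξ : F) : ‖tmul u ξ‖ = ‖u‖ * ‖ξ‖ := by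
  have h := inner_self_eq_norm_sq_to_K (𝕜 := ℂ) (tmul u ξ)
  rw [inner_tmul, inner_self_eq_norm_sq_to_K, inner_self_eq_norm_sq_to_K] at h
  have h' : (‖u‖ * ‖ξ‖) ^ 2 = ‖tmul u ξ‖ ^ 2 := by
    rw [mul_pow]
    exact_mod_cast h
  exact ((pow_left_inj₀ (by positivity) (norm_nonneg _) two_ne_zero).1 h').symm

lemma dense_span_tmul :
    Dense (Submodule.span ℂ {ψ : HTensor E F | ∃ u ξ, ψ = tmul u ξ} : Set (HTensor E F)) := by
  refine UniformSpace.Completion.denseRange_coe.mono ?_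
  rintro _ ⟨z, rfl⟩
  induction z using TensorProduct.induction_on with
  | zero => rw [UniformSpace.Completion.coe_zero]; exact Submodule.zero_mem _
  | tmul u ξ => exact Submodule.subset_span ⟨u, ξ, rfl⟩
  | add x y hx hy => rw [UniformSpace.Completion.coe_add]; exact Submodule.add_mem _ hx hy

variable [CompleteSpace F]

open ContinuousLinearMap (adjoint)

variable (F) in
/-- The map `u ↦ (⟨u| ⊗ 1)`. -/
def contract (u : E) : HTensor E F →L[ℂ] F := adjoint (tmulLeft F u)

lemma inner_contract (u : E) (ψ : HTensor E F) (ξ : F) :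
    ⟪ξ, contract F u ψ⟫_ℂ = ⟪tmul u ξ, ψ⟫_ℂ := by
  simp [contract, ContinuousLinearMap.adjoint_inner_right]

lemma contract_inner (u : E) (ψ : HTensor E F) (ξ : F) :
    ⟪contract F u ψ, ξ⟫_ℂ = ⟪ψ, tmul u ξ⟫_ℂ := by
  simp [contract, ContinuousLinearMap.adjoint_inner_left]

lemma slice_apply (A : HTensor E F →L[ℂ] HTensor E F) (u v : E) (ξ : F) :
    slice A u v ξ = contract F u (A (tmul v ξ)) := rfl

@[simp] lemma contract_tmul (u v : E) (ξ : F) : contract F u (tmul v ξ) = ⟪u, v⟫_ℂ • ξ :=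
  ext_inner_left ℂ fun ζ => by rw [inner_contract, inner_tmul, inner_smul_right]

lemma norm_contract_le (u : E) (ψ : HTensor E F) : ‖contract F u ψ‖ ≤ ‖u‖ * ‖ψ‖ := by
  have h1 : ‖contract F u ψ‖ ^ 2 ≤ ‖contract F u ψ‖ * (‖u‖ * ‖ψ‖) := by
    have h2 := inner_contract u ψ (contract F u ψ)
    rw [inner_self_eq_norm_sq_to_K] at h2
    have h3 : ‖((‖contract F u ψ‖ : ℂ)) ^ 2‖ = ‖contract F u ψ‖ ^ 2 := by simp
    rw [← h3]
    refine (congrArg norm h2).le.trans ((norm_inner_le_norm _ _).trans (le_of_eq ?_))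
    rw [norm_tmul]
    ring
  by_contra! hlt
  have h0 : 0 < ‖contract F u ψ‖ := lt_of_le_of_lt (by positivity) hlt
  nlinarith

section Basis

variable {ι : Type*} (e : HilbertBasis ι ℂ E)

/-- The projection `∑_{k ∈ s} |eₖ⟩⟨eₖ| ⊗ 1`. -/
def truncate (s : Finset ι) : HTensor E F →L[ℂ] HTensor E F :=
  ∑ k ∈ s, tmulLeft F (e k) ∘L contract F (e k)

lemma truncate_apply (s : Finset ι) (ψ : HTensor E F) :
    truncate e s ψ = ∑ k ∈ s, tmul (e k) (contract F (e k) ψ) := by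
  simp [truncate, sum_apply]

lemma inner_truncate (s : Finset ι) (ψ : HTensor E F) :
    ⟪ψ, truncate e s ψ⟫_ℂ = ((∑ k ∈ s, ‖contract F (e k) ψ‖ ^ 2 : ℝ) : ℂ) := by
  rw [truncate_apply, inner_sum]
  push_cast
  refine Finset.sum_congr rfl fun k _ => ?_
  rw [← contract_inner, inner_self_eq_norm_sq_to_K]
  rfl

lemma norm_truncate_sq (s : Finset ι) (ψ : HTensor E F) :
    ‖truncate e s ψ‖ ^ 2 = ∑ k ∈ s, ‖contract F (e k) ψ‖ ^ 2 := by
  classical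
  have h2 : ⟪truncate e s ψ, truncate e s ψ⟫_ℂ = ⟪ψ, truncate e s ψ⟫_ℂ := by
    nth_rewrite 1 [truncate_apply]
    rw [sum_inner, truncate_apply, inner_sum]
    refine Finset.sum_congr rfl fun k hk => ?_
    rw [inner_sum, Finset.sum_eq_single_of_mem k hk]
    · rw [inner_tmul, inner_self_eq_norm_sq_to_K, e.orthonormal.1 k, ← contract_inner]
      simp
    · intro j _ hj
      rw [inner_tmul, e.orthonormal.2 hj.symm, zero_mul]
  exact norm_sq_eq_of_inner_self (h2.trans (inner_truncate e s ψ))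

/-- Pythagoras for the projection `truncate`. It lets a truncation error be computed from a full
trace minus finitely many diagonal entries. -/
lemma norm_sub_truncate_sq (s : Finset ι) (ψ : HTensor E F) :
    ‖ψ - truncate e s ψ‖ ^ 2 = ‖ψ‖ ^ 2 - ∑ k ∈ s, ‖contract F (e k) ψ‖ ^ 2 := by
  rw [@norm_sub_sq ℂ, inner_truncate, norm_truncate_sq, RCLike.re_eq_complex_re, Complex.ofReal_re]
  ring

lemma norm_truncate_le (s : Finset ι) (ψ : HTensor E F) : ‖truncate e s ψ‖ ≤ ‖ψ‖ := by
  have h := norm_sub_truncate_sq e s ψ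
  rw [← norm_truncate_sq] at h
  have := sq_nonneg ‖ψ - truncate e s ψ‖
  exact le_of_sq_le_sq (by linarith) (norm_nonneg _)

/-- On a product vector this is the basis expansion of its first factor; the truncations are
contractions, so density of the span of product vectors gives the rest. -/
lemma tendsto_truncate (ψ : HTensor E F) :
    Tendsto (fun s => truncate e s ψ) atTop (𝓝 ψ) := by
  classical
  have htm : ∀ (u : E) (ξ : F), Tendsto (fun s => truncate e s (tmul u ξ)) atTop
      (𝓝 (tmul u ξ)) := fun u ξ => by
    have h := ((tmulRight E ξ).hasSum (e.hasSum_repr u))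
    rw [HasSum, SummationFilter.unconditional_filter] at h
    refine h.congr fun s => ?_
    rw [truncate_apply]
    refine Finset.sum_congr rfl fun k _ => ?_
    rw [contract_tmul, tmul_smul_right, map_smul, tmulRight_apply, e.repr_apply_apply]
  have hspan : ∀ φ ∈ Submodule.span ℂ {ψ : HTensor E F | ∃ u ξ, ψ = tmul u ξ},
      Tendsto (fun s => truncate e s φ) atTop (𝓝 φ) := fun φ hφ => by
    induction hφ using Submodule.span_induction with
    | mem x hx => obtain ⟨u, ξ, rfl⟩ := hx; exact htm u ξ
    | zero => simp
    | add x y _ _ hx hy => simpa using hx.add hy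
    | smul c x _ hx => simpa using hx.const_smul c
  rw [Metric.tendsto_atTop]
  intro ε hε
  obtain ⟨φ, hφ, hd⟩ := Metric.dense_iff.1 dense_span_tmul ψ (ε / 3) (by positivity)
  obtain ⟨s₀, hs₀⟩ := Metric.tendsto_atTop.1 (hspan φ hd) (ε / 3) (by positivity)
  refine ⟨s₀, fun s hs => ?_⟩
  have h1 := hs₀ s hs
  rw [Metric.mem_ball] at hφ
  have h2 : dist (truncate e s ψ) (truncate e s φ) ≤ dist φ ψ := by
    rw [dist_eq_norm, ← map_sub, dist_comm, dist_eq_norm]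
    exact norm_truncate_le e s _
  linarith [dist_triangle4 (truncate e s ψ) (truncate e s φ) φ ψ]

lemma hasSum_tmul_contract (ψ : HTensor E F) :
    HasSum (fun k => tmul (e k) (contract F (e k) ψ)) ψ := by
  rw [HasSum, SummationFilter.unconditional_filter]
  simpa only [truncate_apply] using tendsto_truncate e ψ

lemma hasSum_norm_contract_sq (ψ : HTensor E F) :
    HasSum (fun k => ‖contract F (e k) ψ‖ ^ 2) (‖ψ‖ ^ 2) := by
  rw [HasSum, SummationFilter.unconditional_filter]
  simpa only [norm_truncate_sq] using ((tendsto_truncate e ψ).norm.pow 2)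

end Basis

end TensorExpansion

/-! ### The channels Tr_H[A (ρ ⊗ |Ω⟩⟨Ω|) A*] and their composition -/

section PartialTrace

variable {h H : Type*} [NormedAddCommGroup h] [InnerProductSpace ℂ h] [CompleteSpace h]
variable [NormedAddCommGroup H] [InnerProductSpace ℂ H] [CompleteSpace H]

open ContinuousLinearMap (adjoint)

/-- The map `ρ ↦ Tr_H[A (ρ ⊗ |Ω⟩⟨Ω|) A*]`. -/
def channel (Ω : H) (A : HTensor h H →L[ℂ] HTensor h H) : TraceClass h →L[ℂ] TraceClass h :=
  ptrace ∘L TraceClass.sandwich A ∘L ampliate Ω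

lemma semigroupZ_eq (U : ℝ → ℝ → HTensor h H →L[ℂ] HTensor h H) (Ω : H) (t : ℝ) :
    semigroupZ U Ω t = channel Ω (U 0 t) := rfl

lemma semigroupF_eq (U : ℝ → ℝ → HTensor h H →L[ℂ] HTensor h H) (Ω : H) (t : ℝ) :
    semigroupF U Ω t = channel Ω (adjoint (U 0 t)) := rfl

/-- The component `(1 ⊗ ⟨ξ|) ψ`. -/
def component (ξ : H) : HTensor h H →L[ℂ] h := adjoint (tmulRight h ξ)

lemma inner_component (ξ : H) (ψ : HTensor h H) (u : h) :
    ⟪u, component ξ ψ⟫_ℂ = ⟪tmul u ξ, ψ⟫_ℂ := by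
  simp [component, ContinuousLinearMap.adjoint_inner_right]

lemma component_inner (ξ : H) (ψ : HTensor h H) (u : h) :
    ⟪component ξ ψ, u⟫_ℂ = ⟪ψ, tmul u ξ⟫_ℂ := by
  simp [component, ContinuousLinearMap.adjoint_inner_left]

lemma inner_component' (ξ : H) (ψ : HTensor h H) (u : h) :
    ⟪u, component ξ ψ⟫_ℂ = ⟪ξ, contract H u ψ⟫_ℂ := by
  rw [inner_component, inner_contract]

lemma component_inner' (ξ : H) (ψ : HTensor h H) (u : h) :
    ⟪component ξ ψ, u⟫_ℂ = ⟪contract H u ψ, ξ⟫_ℂ := by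
  rw [component_inner, contract_inner]

lemma sandwich_ampliate_rankOne_apply (Ω : H) (A : HTensor h H →L[ℂ] HTensor h H) (w v : h)
    (ψ : HTensor h H) :
    TraceClass.toOp _ (TraceClass.sandwich A (ampliate Ω (TraceClass.rankOne w v))) ψ =
      ⟪A (tmul v Ω), ψ⟫_ℂ • A (tmul w Ω) := by
  simp only [ampliate, TraceClass.toOp_sandwich, ContinuousLinearMap.comp_apply,
    TraceClass.toOp_rankOne, ContinuousLinearMap.adjoint_inner_right, map_smul, tmulRight_apply]

lemma inner_channel_rankOne_tsum (Ω : H) (A : HTensor h H →L[ℂ] HTensor h H) (w v u p : h) :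
    ⟪u, TraceClass.toOp h (channel Ω A (TraceClass.rankOne w v)) p⟫_ℂ =
      ∑' j, ⟪u, component (onb H j) (A (tmul w Ω))⟫_ℂ *
        ⟪component (onb H j) (A (tmul v Ω)), p⟫_ℂ := by
  rw [channel, ContinuousLinearMap.comp_apply, ContinuousLinearMap.comp_apply, toOp_ptrace,
    inner_ptraceOp]
  refine tsum_congr fun j => ?_
  rw [sandwich_ampliate_rankOne_apply, inner_smul_right, inner_component, component_inner, mul_comm]

/-- Parseval in `H` folds the partial trace into a single inner product. Through this identity every
statement about channels becomes one about vacuum moments of slices. -/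
lemma inner_channel_rankOne (Ω : H) (A : HTensor h H →L[ℂ] HTensor h H) (w v u p : h) :
    ⟪u, TraceClass.toOp h (channel Ω A (TraceClass.rankOne w v)) p⟫_ℂ =
      ⟪slice A p v Ω, slice A u w Ω⟫_ℂ := by
  rw [inner_channel_rankOne_tsum, ← (onb H).tsum_inner_mul_inner]
  refine tsum_congr fun j => ?_
  rw [inner_component', component_inner', slice_apply, slice_apply, mul_comm]

lemma summable_norm_component_sq (ψ : HTensor h H) :
    Summable fun j => ‖component (onb H j) ψ‖ ^ 2 := by
  classical
  refine summable_of_sum_le (c := ‖ψ‖ ^ 2) (fun _ => by positivity) fun s => ?_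
  -- The part of ψ lying in h ⊗ span of the chosen basis vectors; ⟨φ, φ⟩ = ⟨φ, ψ⟩ makes it an
  -- orthogonal projection of ψ, whence Bessel.
  set φ : HTensor h H := ∑ j ∈ s, tmul (component (onb H j) ψ) (onb H j) with hφ
  have h1 : ⟪φ, ψ⟫_ℂ = ((∑ j ∈ s, ‖component (onb H j) ψ‖ ^ 2 : ℝ) : ℂ) := by
    rw [hφ, sum_inner]
    push_cast
    refine Finset.sum_congr rfl fun j _ => ?_
    rw [← inner_component, inner_self_eq_norm_sq_to_K]
    rfl
  have h2 : ⟪φ, φ⟫_ℂ = ⟪φ, ψ⟫_ℂ := by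
    rw [h1]
    push_cast
    nth_rewrite 1 [hφ]
    rw [sum_inner]
    refine Finset.sum_congr rfl fun j hj => ?_
    rw [hφ, inner_sum, Finset.sum_eq_single_of_mem j hj]
    · rw [inner_tmul, inner_self_eq_norm_sq_to_K, inner_self_eq_norm_sq_to_K,
        (onb H).orthonormal.1 j]
      simp
    · intro i _ hi
      rw [inner_tmul, (onb H).orthonormal.2 hi.symm, mul_zero]
  have h3 : ‖φ‖ ^ 2 = ∑ j ∈ s, ‖component (onb H j) ψ‖ ^ 2 :=
    norm_sq_eq_of_inner_self (h2.trans h1)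
  have h4 : ‖φ - ψ‖ ^ 2 = ‖ψ‖ ^ 2 - ‖φ‖ ^ 2 := by
    rw [@norm_sub_sq ℂ, h1, h3, RCLike.re_eq_complex_re, Complex.ofReal_re]
    ring
  rw [← h3]
  linarith [sq_nonneg ‖φ - ψ‖]

lemma summable_norm_mul_norm {ι : Type*} {a b : ι → h} (ha : Summable fun j => ‖a j‖ ^ 2)
    (hb : Summable fun j => ‖b j‖ ^ 2) : Summable fun j => ‖a j‖ * ‖b j‖ :=
  Summable.of_nonneg_of_le (fun _ => by positivity)
    (fun j => by nlinarith [sq_nonneg (‖a j‖ - ‖b j‖)]) (ha.add hb)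

/-- A Kraus expansion of the output. Its convergence in the trace norm allows a second channel, or
any bounded functional, to be applied term by term. -/
lemma hasSum_channel_rankOne (Ω : H) (A : HTensor h H →L[ℂ] HTensor h H) (w v : h) :
    HasSum (fun j => TraceClass.rankOne (component (onb H j) (A (tmul w Ω)))
      (component (onb H j) (A (tmul v Ω)))) (channel Ω A (TraceClass.rankOne w v)) :=
  TraceClass.hasSum_rankOne
    (summable_norm_mul_norm (summable_norm_component_sq _) (summable_norm_component_sq _))
    (inner_channel_rankOne_tsum Ω A w v)

lemma tracePair_one_channel_rankOne (Ω : H) (A : HTensor h H →L[ℂ] HTensor h H) (v : h) :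
    TraceClass.tracePair 1 (channel Ω A (TraceClass.rankOne v v)) =
      ((‖A (tmul v Ω)‖ ^ 2 : ℝ) : ℂ) := by
  rw [TraceClass.tracePair_apply, ← (hasSum_norm_contract_sq (onb h) (A (tmul v Ω))).tsum_eq,
    Complex.ofReal_tsum]
  refine tsum_congr fun k => ?_
  rw [← ContinuousLinearMap.star_eq_adjoint, star_one, one_apply_eq_self,
    inner_channel_rankOne, slice_apply, inner_self_eq_norm_sq_to_K]
  simp

/-- The matrix entries of an operator product in terms of the slices of the factors. -/
lemma hasSum_slice_comp (A B : HTensor h H →L[ℂ] HTensor h H) (u v : h) (ξ : H) :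
    HasSum (fun k => slice A u (onb h k) (slice B (onb h k) v ξ)) (slice (A ∘L B) u v ξ) := by
  have := (contract H u ∘L A).hasSum (hasSum_tmul_contract (onb h) (B (tmul v ξ)))
  exact this

/-- The entries of `channel Ω A` as a bounded form in the input state. -/
lemma exists_dual_channel (Ω : H) (A : HTensor h H →L[ℂ] HTensor h H) (u p : h) :
    ∃ y : h →L[ℂ] h, ∀ a b, ⟪b, y a⟫_ℂ = ⟪slice A p b Ω, slice A u a Ω⟫_ℂ := by
  refine ⟨adjoint (contract H p ∘L A ∘L tmulRight h Ω) ∘L (contract H u ∘L A ∘L tmulRight h Ω),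
    fun a b => ?_⟩
  rw [ContinuousLinearMap.comp_apply, ContinuousLinearMap.adjoint_inner_right]
  rfl

/-- If `A` is independent of `B` in the state `Ω`, the channel of `A B` is the composition of the
channels. -/
lemma channel_comp_rankOne (Ω : H) (A B : HTensor h H →L[ℂ] HTensor h H)
    (hAB : ∀ a b c d p q v w : h,
      ⟪slice A a p (slice B c v Ω), slice A b q (slice B d w Ω)⟫_ℂ =
        ⟪slice A a p Ω, slice A b q Ω⟫_ℂ * ⟪slice B c v Ω, slice B d w Ω⟫_ℂ) (w v : h) :
    channel Ω (A ∘L B) (TraceClass.rankOne w v) =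
      channel Ω A (channel Ω B (TraceClass.rankOne w v)) := by
  classical
  refine TraceClass.ext_inner fun u p => ?_
  -- The operator y is the Heisenberg picture image of |u⟩⟨p| under A. Having the entry of the outer
  -- channel as a bounded form is what permits the passage to the limit below.
  obtain ⟨y, hy⟩ := exists_dual_channel Ω A u p
  set a := fun j => component (onb H j) (B (tmul w Ω)) with ha
  set b := fun j => component (onb H j) (B (tmul v Ω)) with hb
  have hs : Summable fun j => ‖a j‖ * ‖b j‖ :=
    summable_norm_mul_norm (summable_norm_component_sq _) (summable_norm_component_sq _)
  have hR : ⟪u, TraceClass.toOp h (channel Ω A (channel Ω B (TraceClass.rankOne w v))) p⟫_ℂ =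
      ∑' j, ⟪b j, y (a j)⟫_ℂ := by
    have := ((TraceClass.entry u p) ∘L channel Ω A).hasSum (hasSum_channel_rankOne Ω B w v)
    refine this.tsum_eq.symm.trans ?_
    refine tsum_congr fun j => ?_
    simp only [ContinuousLinearMap.comp_apply, TraceClass.entry_apply,
      inner_channel_rankOne, hy, ha, hb]
  rw [hR, inner_channel_rankOne]
  -- both sides are limits of truncated sums over a basis of `h`
  set P : Finset (exists_hilbertBasis ℂ h).choose → h → h := fun s x =>
    ∑ k ∈ s, ⟪onb h k, x⟫_ℂ • onb h k with hP
  have hPt : ∀ x, Tendsto (fun s => P s x) atTop (𝓝 x) := fun x => by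
    have h1 := (onb h).hasSum_repr x
    rw [HasSum, SummationFilter.unconditional_filter] at h1
    simpa only [HilbertBasis.repr_apply_apply] using h1
  have hPn : ∀ s x, ‖P s x‖ ≤ ‖x‖ := fun s x => by
    have h1 : ‖P s x‖ ^ 2 = ∑ k ∈ s, ‖⟪onb h k, x⟫_ℂ‖ ^ 2 := by
      have h2 := inner_self_eq_norm_sq_to_K (𝕜 := ℂ) (P s x)
      rw [hP, (onb h).orthonormal.inner_sum] at h2
      simp only [RCLike.conj_mul] at h2
      exact_mod_cast h2.symm
    refine le_of_sq_le_sq ?_ (norm_nonneg _)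
    rw [h1]
    exact (onb h).orthonormal.sum_inner_products_le x
  have hL1 : Tendsto (fun s => ⟪∑ l ∈ s, slice A p (onb h l) (slice B (onb h l) v Ω),
      ∑ k ∈ s, slice A u (onb h k) (slice B (onb h k) w Ω)⟫_ℂ) atTop
      (𝓝 ⟪slice (A ∘L B) p v Ω, slice (A ∘L B) u w Ω⟫_ℂ) := by
    have h1 := hasSum_slice_comp A B p v Ω
    have h2 := hasSum_slice_comp A B u w Ω
    rw [HasSum, SummationFilter.unconditional_filter] at h1 h2
    exact h1.inner h2
  -- Independence applies to one pair of basis indices at a time, hence to the doubly truncated sum;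
  -- Parseval in `H` then reassembles the inner channel with both components truncated.
  have hL2 : ∀ s, ⟪∑ l ∈ s, slice A p (onb h l) (slice B (onb h l) v Ω),
      ∑ k ∈ s, slice A u (onb h k) (slice B (onb h k) w Ω)⟫_ℂ =
        ∑' j, ⟪P s (b j), y (P s (a j))⟫_ℂ := fun s => by
    have h1 : ∀ k l, HasSum (fun j => ⟪onb h l, y (onb h k)⟫_ℂ *
        (⟪b j, onb h l⟫_ℂ * ⟪onb h k, a j⟫_ℂ))
        ⟪slice A p (onb h l) (slice B (onb h l) v Ω),
          slice A u (onb h k) (slice B (onb h k) w Ω)⟫_ℂ := fun k l => by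
      rw [hAB, ← hy]
      refine HasSum.mul_left _ ?_
      simp only [ha, hb, component_inner', inner_component']
      exact (onb H).hasSum_inner_mul_inner _ _
    have h2 := hasSum_sum (s := s) fun l _ => hasSum_sum (s := s) fun k _ => h1 k l
    rw [sum_inner]
    simp only [inner_sum]
    rw [← h2.tsum_eq]
    refine tsum_congr fun j => ?_
    simp only [hP, map_sum, map_smul]
    rw [sum_inner]
    refine Finset.sum_congr rfl fun l _ => ?_
    rw [inner_sum]
    refine Finset.sum_congr rfl fun k _ => ?_
    rw [inner_smul_left, inner_smul_right, inner_conj_symm]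
    ring
  refine tendsto_nhds_unique (hL1.congr hL2) ?_
  -- The truncations are contractions, so ‖y‖‖aⱼ‖‖bⱼ‖ dominates uniformly in s.
  refine tendsto_tsum_of_dominated_convergence (hs.mul_left ‖y‖) (fun j => ?_)
    (Eventually.of_forall fun s j => ?_)
  · exact (hPt _).inner ((y.continuous.tendsto _).comp (hPt _))
  · calc ‖⟪P s (b j), y (P s (a j))⟫_ℂ‖ ≤ ‖P s (b j)‖ * (‖y‖ * ‖P s (a j)‖) :=
          (norm_inner_le_norm _ _).trans (by gcongr; exact y.le_opNorm _)
      _ ≤ ‖b j‖ * (‖y‖ * ‖a j‖) := by gcongr <;> exact hPn _ _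
      _ = _ := by ring

end PartialTrace

/-! ### Contraction semigroups, eigenfunctionals of generators and cores -/

section Semigroup

variable {X : Type*} [NormedAddCommGroup X] [NormedSpace ℂ X]

lemma generator_apply {T : ℝ → X →L[ℂ] X} (x : (generator T).domain) :
    HasGenerator T x (generator T x) := x.2.choose_spec

lemma HasGenerator.mem_domain {T : ℝ → X →L[ℂ] X} {x y : X} (hx : HasGenerator T x y) :
    x ∈ (generator T).domain := ⟨y, hx⟩

lemma HasGenerator.unique {T : ℝ → X →L[ℂ] X} {x y y' : X} (hx : HasGenerator T x y)
    (hx' : HasGenerator T x y') : y = y' := tendsto_nhds_unique hx hx'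

/-- `T` acts on the orbit of `x` as a contraction semigroup. -/
structure ContractiveOrbit (T : ℝ → X →L[ℂ] X) (x : X) : Prop where
  norm_le : ∀ t, 0 ≤ t → ‖T t‖ ≤ 1
  zero : T 0 x = x
  add : ∀ s t, 0 ≤ s → 0 ≤ t → T (s + t) x = T s (T t x)

variable {T : ℝ → X →L[ℂ] X} {x y : X}

lemma ContractiveOrbit.norm_apply_le (hT : ContractiveOrbit T x) {t : ℝ} (ht : 0 ≤ t) (z : X) :
    ‖T t z‖ ≤ ‖z‖ := by
  simpa using (T t).le_of_opNorm_le (hT.norm_le t ht) z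

/-- The domain of the generator is invariant. -/
lemma ContractiveOrbit.hasGenerator_apply (hT : ContractiveOrbit T x) (hx : HasGenerator T x y)
    {t : ℝ} (ht : 0 ≤ t) : HasGenerator T (T t x) (T t y) := by
  refine (((T t).continuous.tendsto y).comp hx).congr' ?_
  filter_upwards [self_mem_nhdsWithin] with r hr
  have hr' : (0 : ℝ) ≤ r := le_of_lt hr
  rw [Function.comp_apply, map_smul, map_sub, ← hT.add t r ht hr', ← hT.add r t hr' ht, add_comm]

/-- The right difference quotient at t is `T t` applied to the one at 0. A right derivative is all
the definition of the generator provides, and it suffices for the mean value arguments. -/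
lemma ContractiveOrbit.hasDerivWithinAt (hT : ContractiveOrbit T x) (hx : HasGenerator T x y)
    {t : ℝ} (ht : 0 ≤ t) : HasDerivWithinAt (fun r => T r x) (T t y) (Set.Ici t) t := by
  rw [← hasDerivWithinAt_Ioi_iff_Ici, hasDerivWithinAt_iff_tendsto_slope' (by simp)]
  have hshift : Tendsto (fun r => r - t) (𝓝[>] t) (𝓝[>] 0) := by
    refine tendsto_nhdsWithin_iff.2 ⟨?_, ?_⟩
    · have : Tendsto (fun r => r - t) (𝓝 t) (𝓝 (t - t)) :=
        (continuous_id.sub continuous_const).tendsto t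
      rw [sub_self] at this
      exact this.mono_left nhdsWithin_le_nhds
    · filter_upwards [self_mem_nhdsWithin] with r hr
      exact Set.mem_Ioi.2 (sub_pos.2 (Set.mem_Ioi.1 hr))
  refine ((((T t).continuous.tendsto y).comp hx).comp hshift).congr' ?_
  filter_upwards [self_mem_nhdsWithin] with r hr
  have hr' : (0 : ℝ) ≤ r - t := (sub_pos.2 (Set.mem_Ioi.1 hr)).le
  simp only [Function.comp_apply, map_smul, map_sub, ← hT.add t _ ht hr', add_sub_cancel]
  rw [slope_def_module, ← Complex.ofReal_inv, Complex.coe_smul]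

/-- Contractivity moves any increment of the orbit back to 0, where differentiability gives right
continuity; this also handles continuity from the left. -/
lemma ContractiveOrbit.continuousOn (hT : ContractiveOrbit T x) (hx : HasGenerator T x y) :
    ContinuousOn (fun r => T r x) (Set.Ici 0) := by
  have h0 : Tendsto (fun r => ‖T r x - x‖) (𝓝[≥] 0) (𝓝 0) := by
    have := (hT.hasDerivWithinAt hx le_rfl).continuousWithinAt
    rw [ContinuousWithinAt, hT.zero] at this
    exact tendsto_iff_norm_sub_tendsto_zero.1 this
  have key : ∀ r s : ℝ, 0 ≤ r → r ≤ s → ‖T s x - T r x‖ ≤ ‖T (s - r) x - x‖ := fun r s hr hrs => by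
    have h1 : T s x = T r (T (s - r) x) := by
      rw [← hT.add r _ hr (sub_nonneg.2 hrs), add_sub_cancel]
    rw [h1, ← map_sub]
    exact hT.norm_apply_le hr _
  intro t ht
  rw [ContinuousWithinAt, tendsto_iff_norm_sub_tendsto_zero]
  have habs : Tendsto (fun r => |r - t|) (𝓝[Set.Ici 0] t) (𝓝[≥] 0) := by
    refine tendsto_nhdsWithin_iff.2 ⟨?_, Eventually.of_forall fun r => Set.mem_Ici.2 (abs_nonneg _)⟩
    have : Tendsto (fun r => |r - t|) (𝓝 t) (𝓝 |t - t|) :=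
      (continuous_abs.comp (continuous_id.sub continuous_const)).tendsto t
    rw [sub_self, abs_zero] at this
    exact this.mono_left nhdsWithin_le_nhds
  refine squeeze_zero' (Eventually.of_forall fun _ => norm_nonneg _) ?_
    (h0.comp habs)
  filter_upwards [self_mem_nhdsWithin] with r hr
  rcases le_total r t with hrt | hrt
  · rw [Function.comp_apply, abs_sub_comm, abs_of_nonneg (sub_nonneg.2 hrt), norm_sub_rev]
    exact key r t hr hrt
  · rw [Function.comp_apply, abs_of_nonneg (sub_nonneg.2 hrt)]
    exact key t r ht hrt

/-- A bounded eigenfunctional of the generator for a positive eigenvalue vanishes on its domain. -/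
lemma ContractiveOrbit.eq_zero_of_eigen (hT : ContractiveOrbit T x) (hx : HasGenerator T x y)
    (φ : X →L[ℂ] ℂ) {lam : ℝ} (hlam : 0 < lam)
    (hφ : ∀ a b, HasGenerator T a b → φ b = lam * φ a) : φ x = 0 := by
  -- The orbit stays in the domain, so the eigenvalue equation along it cancels the derivative of
  -- the exponential; g is constant, yet bounded by a multiple of exp(-λt).
  set g : ℝ → ℂ := fun t => (Real.exp (-(lam * t)) : ℂ) * φ (T t x) with hg
  have hderiv : ∀ t, 0 ≤ t → HasDerivWithinAt g 0 (Set.Ici t) t := fun t ht => by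
    have h1 : HasDerivWithinAt (fun r => φ (T r x)) (lam * φ (T t x)) (Set.Ici t) t := by
      rw [← hφ _ _ (hT.hasGenerator_apply hx ht)]
      exact (φ.restrictScalars ℝ).hasFDerivAt.comp_hasDerivWithinAt t (hT.hasDerivWithinAt hx ht)
    have h2 : HasDerivAt (fun r : ℝ => Real.exp (-(lam * r))) (Real.exp (-(lam * t)) * -(lam * 1)) t :=
      (((hasDerivAt_id t).const_mul lam).neg).exp
    have h3 := h2.ofReal_comp.hasDerivWithinAt (s := Set.Ici t) |>.mul h1
    refine h3.congr_deriv ?_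
    push_cast
    ring
  have hcont : ContinuousOn g (Set.Ici 0) :=
    ContinuousOn.mul (by fun_prop) (φ.continuous.comp_continuousOn (hT.continuousOn hx))
  have hconst : ∀ t, 0 ≤ t → g t = φ x := fun t ht => by
    have := constant_of_has_deriv_right_zero (f := g) (a := 0) (b := t)
      (hcont.mono fun r hr => hr.1) (fun r hr => hderiv r hr.1) t ⟨ht, le_rfl⟩
    rw [this, hg]
    simp [hT.zero]
  have hlim : Tendsto (fun t : ℝ => Real.exp (-(lam * t)) * (‖φ‖ * ‖x‖)) atTop (𝓝 0) := by
    have h1 : Tendsto (fun t : ℝ => lam * t) atTop atTop := tendsto_id.const_mul_atTop hlam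
    simpa using ((Real.tendsto_exp_neg_atTop_nhds_zero.comp h1).mul_const (‖φ‖ * ‖x‖))
  have hle : ∀ᶠ t : ℝ in atTop, ‖φ x‖ ≤ Real.exp (-(lam * t)) * (‖φ‖ * ‖x‖) := by
    filter_upwards [eventually_ge_atTop 0] with t ht
    rw [← hconst t ht, hg, norm_mul, Complex.norm_real, Real.norm_of_nonneg (Real.exp_pos _).le]
    gcongr
    exact (φ.le_opNorm _).trans (by gcongr; exact hT.norm_apply_le ht x)
  exact norm_le_zero_iff.1 (ge_of_tendsto hlim hle)

variable {Y : Type*} [NormedAddCommGroup Y] [NormedSpace ℂ Y]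

/-- An operator with core `S` has its graph in the closure of the graph over `S`. -/
lemma mem_closure_graph_of_hasCore {A : X →ₗ.[ℂ] Y} {S : Submodule ℂ X} (hS : A.HasCore S)
    (x : A.domain) :
    ((x : X), A x) ∈ closure {p : X × Y | ∃ s : A.domain, (s : X) ∈ S ∧ p = (↑s, A s)} := by
  have h1 : A.graph ≤ (A.domRestrict S).graph.topologicalClosure := by
    -- If the restriction is not closable, its `closure` is by default the restriction itself, and
    -- the core property then says that it already equals A.
    by_cases hc : (A.domRestrict S).IsClosable
    · rw [hc.graph_closure_eq_closure_graph, hS.closure_eq]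
    · have : (A.domRestrict S).closure = A.domRestrict S := LinearPMap.closure_def' hc
      rw [← this, hS.closure_eq]
      exact Submodule.le_topologicalClosure _
  refine closure_mono ?_ (h1 (A.mem_graph x))
  rintro ⟨a, b⟩ hab
  obtain ⟨z, hz, hz'⟩ := (LinearPMap.mem_graph_iff _).1 hab
  refine ⟨⟨z, z.2.2⟩, z.2.1, ?_⟩
  rw [Prod.ext_iff]
  exact ⟨hz.symm, hz'.symm⟩

end Semigroup

/-! ### Weak derivative of the adjoint semigroup -/

section AdjointGenerator

variable {E : Type*} [NormedAddCommGroup E] [InnerProductSpace ℂ E] [CompleteSpace E]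

open ContinuousLinearMap (adjoint)

/-- The adjoint semigroup is weakly differentiable at `0` on the domain of the adjoint of the
generator. -/
lemma tendsto_inner_adjoint_generator {T : ℝ → E →L[ℂ] E}
    (hT : ∀ x, ContractiveOrbit T x) (hd : Dense ((generator T).domain : Set E))
    (v : (generator T).adjoint.domain) (u : E) :
    Tendsto (fun t : ℝ => (t : ℂ)⁻¹ * ⟪u, adjoint (T t) v - v⟫_ℂ) (𝓝[>] 0)
      (𝓝 ⟪u, (generator T).adjoint v⟫_ℂ) := by
  set w := (generator T).adjoint v with hw
  have hadj : ∀ x y, HasGenerator T x y → ⟪y, (v : E)⟫_ℂ = ⟪x, w⟫_ℂ := fun x y hxy => by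
    have := LinearPMap.adjoint_isFormalAdjoint hd v ⟨x, hxy.mem_domain⟩
    rw [← inner_conj_symm y, ← inner_conj_symm x, hw, this,
      (generator_apply ⟨x, hxy.mem_domain⟩).unique hxy]
  -- Along an orbit the derivative of ⟨v, T_r x⟩ equals ⟨w, T_r x⟩, of modulus at most ‖w‖‖x‖. The
  -- bound does not involve Gx, so it survives the passage to arbitrary x and controls the
  -- difference quotients uniformly in t.
  have hbound1 : ∀ x ∈ (generator T).domain, ∀ t : ℝ, 0 ≤ t →
      ‖⟪T t x - x, (v : E)⟫_ℂ‖ ≤ ‖x‖ * ‖w‖ * t := by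
    rintro x ⟨y, hxy⟩ t ht
    have hc : ContinuousOn (fun r => ⟪(v : E), T r x⟫_ℂ) (Set.Icc 0 t) :=
      (continuousOn_const.inner (((hT x).continuousOn hxy).mono fun r hr => hr.1))
    have hder : ∀ r ∈ Set.Ico 0 t,
        HasDerivWithinAt (fun r => ⟪(v : E), T r x⟫_ℂ) ⟪(v : E), T r y⟫_ℂ (Set.Ici r) r := fun r hr =>
      ((innerSL ℂ (v : E)).restrictScalars ℝ).hasFDerivAt.comp_hasDerivWithinAt r
        ((hT x).hasDerivWithinAt hxy hr.1)
    have := norm_image_sub_le_of_norm_deriv_right_le_segment hc hder (C := ‖x‖ * ‖w‖)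
      (fun r hr => by
        rw [norm_inner_symm, hadj _ _ ((hT x).hasGenerator_apply hxy hr.1)]
        refine (norm_inner_le_norm _ _).trans ?_
        gcongr
        exact (hT x).norm_apply_le hr.1 x) t ⟨ht, le_rfl⟩
    rwa [(hT x).zero, ← inner_sub_right, norm_inner_symm, sub_zero] at this
  have hbound : ∀ x : E, ∀ t : ℝ, 0 ≤ t → ‖⟪x, adjoint (T t) v - v⟫_ℂ‖ ≤ ‖x‖ * ‖w‖ * t := by
    intro x t ht
    have hcl : IsClosed {x : E | ‖⟪x, adjoint (T t) v - v⟫_ℂ‖ ≤ ‖x‖ * ‖w‖ * t} :=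
      isClosed_le (by fun_prop) (by fun_prop)
    refine hcl.closure_subset_iff.2 (fun x hx => ?_) (hd x)
    have := hbound1 x hx t ht
    rwa [inner_sub_left, ← ContinuousLinearMap.adjoint_inner_right, ← inner_sub_right] at this
  have hlim : ∀ x ∈ (generator T).domain,
      Tendsto (fun t : ℝ => (t : ℂ)⁻¹ * ⟪x, adjoint (T t) v - v⟫_ℂ) (𝓝[>] 0) (𝓝 ⟪x, w⟫_ℂ) := by
    rintro x ⟨y, hxy⟩
    rw [← hadj x y hxy]
    refine (hxy.inner tendsto_const_nhds).congr fun t => ?_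
    rw [inner_smul_left, inner_sub_left, inner_sub_right, ContinuousLinearMap.adjoint_inner_right,
      map_inv₀, Complex.conj_ofReal]
  rw [Metric.tendsto_nhds]
  intro ε hε
  obtain ⟨x, hxu, hx⟩ := Metric.dense_iff.1 hd u (ε / (3 * (‖w‖ + 1))) (by positivity)
  rw [Metric.mem_ball, dist_eq_norm, norm_sub_rev, lt_div_iff₀ (by positivity)] at hxu
  have hux : ‖u - x‖ * ‖w‖ < ε / 3 := by
    have := norm_nonneg (u - x)
    nlinarith
  filter_upwards [Metric.tendsto_nhds.1 (hlim x hx) (ε / 3) (by positivity),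
    self_mem_nhdsWithin] with t ht ht0
  have ht0' : (0 : ℝ) < t := ht0
  have h1 : ‖(t : ℂ)⁻¹ * ⟪u, adjoint (T t) v - v⟫_ℂ - (t : ℂ)⁻¹ * ⟪x, adjoint (T t) v - v⟫_ℂ‖
      ≤ ‖u - x‖ * ‖w‖ := by
    rw [← mul_sub, ← inner_sub_left, norm_mul, norm_inv, Complex.norm_real,
      Real.norm_of_nonneg ht0'.le, inv_mul_le_iff₀ ht0', mul_comm]
    exact hbound _ t ht0'.le
  have h2 : ‖⟪x, w⟫_ℂ - ⟪u, w⟫_ℂ‖ ≤ ‖u - x‖ * ‖w‖ := by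
    rw [← inner_sub_left, norm_sub_rev u]
    exact norm_inner_le_norm _ _
  rw [← dist_eq_norm] at h1 h2
  linarith [dist_triangle4 ((t : ℂ)⁻¹ * ⟪u, adjoint (T t) v - v⟫_ℂ)
    ((t : ℂ)⁻¹ * ⟪x, adjoint (T t) v - v⟫_ℂ) ⟪x, w⟫_ℂ ⟪u, w⟫_ℂ]

end AdjointGenerator

/-! ### Adjoints of slices and slices of unitaries -/

section Slices

variable {E F : Type*} [NormedAddCommGroup E] [InnerProductSpace ℂ E] [CompleteSpace E]
variable [NormedAddCommGroup F] [InnerProductSpace ℂ F] [CompleteSpace F]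

open ContinuousLinearMap (adjoint)

lemma slice_inner (A : HTensor E F →L[ℂ] HTensor E F) (u v : E) (ξ₁ ξ₂ : F) :
    ⟪slice A u v ξ₁, ξ₂⟫_ℂ = ⟪ξ₁, slice (adjoint A) v u ξ₂⟫_ℂ := by
  rw [inner_slice, ← inner_conj_symm, inner_slice, ContinuousLinearMap.adjoint_inner_right,
    inner_conj_symm]

lemma adjoint_slice (A : HTensor E F →L[ℂ] HTensor E F) (u v : E) :
    adjoint (slice A u v) = slice (adjoint A) v u :=
  ContinuousLinearMap.ext fun ξ => ext_inner_left ℂ fun ζ => by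
    rw [ContinuousLinearMap.adjoint_inner_right, slice_inner]

lemma slice_sub (A B : HTensor E F →L[ℂ] HTensor E F) (u v : E) :
    slice (A - B) u v = slice A u v - slice B u v := by
  ext ξ
  simp [slice_apply]

lemma slice_one_apply (u v : E) (ξ : F) : slice 1 u v ξ = ⟪u, v⟫_ℂ • ξ := by
  rw [slice_apply, one_apply_eq_self, contract_tmul]

lemma adjoint_starIf (ε : Bool) (A : HTensor E F →L[ℂ] HTensor E F) :
    adjoint (starIf ε A) = starIf (!ε) A := by
  cases ε <;> simp [starIf]

lemma starIf_mem_unitary {ε : Bool} {A : HTensor E F →L[ℂ] HTensor E F}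
    (hA : A ∈ unitary (HTensor E F →L[ℂ] HTensor E F)) :
    starIf ε A ∈ unitary (HTensor E F →L[ℂ] HTensor E F) := by
  cases ε
  · exact hA
  · exact Unitary.star_mem hA

lemma norm_apply_of_mem_unitary {A : HTensor E F →L[ℂ] HTensor E F}
    (hA : A ∈ unitary (HTensor E F →L[ℂ] HTensor E F)) (ψ : HTensor E F) : ‖A ψ‖ = ‖ψ‖ := by
  have h1 : adjoint A (A ψ) = ψ := by
    have := congrArg (fun B : HTensor E F →L[ℂ] HTensor E F => B ψ) (Unitary.mem_iff.1 hA).1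
    rw [ContinuousLinearMap.star_eq_adjoint] at this
    exact this
  have h2 : ⟪A ψ, A ψ⟫_ℂ = ((‖ψ‖ ^ 2 : ℝ) : ℂ) := by
    rw [← ContinuousLinearMap.adjoint_inner_right, h1, inner_self_eq_norm_sq_to_K]
    simp
  exact (pow_left_inj₀ (norm_nonneg _) (norm_nonneg _) two_ne_zero).1 (norm_sq_eq_of_inner_self h2)

lemma norm_le_one_of_mem_unitary {A : HTensor E F →L[ℂ] HTensor E F}
    (hA : A ∈ unitary (HTensor E F →L[ℂ] HTensor E F)) : ‖A‖ ≤ 1 :=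
  A.opNorm_le_bound zero_le_one fun ψ => by rw [norm_apply_of_mem_unitary hA, one_mul]

end Slices

/-! ### Semigroup laws from independence and stationarity -/

section Increments

variable {h H : Type*} [NormedAddCommGroup h] [InnerProductSpace ℂ h] [CompleteSpace h]
variable [NormedAddCommGroup H] [InnerProductSpace ℂ H] [CompleteSpace H]

open ContinuousLinearMap (adjoint)

variable (h) in
/-- The closure of the finite rank operators in the trace norm. -/
def finiteRankClosure : Submodule ℂ (TraceClass h) :=
  (rankOneSpan (⊤ : Submodule ℂ h)).topologicalClosure

lemma rankOne_mem_finiteRankClosure (w v : h) :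
    TraceClass.rankOne w v ∈ finiteRankClosure h :=
  Submodule.le_topologicalClosure _
    (Submodule.subset_span ⟨w, Submodule.mem_top, v, Submodule.mem_top, rfl⟩)

lemma eq_on_finiteRankClosure {X : Type*} [NormedAddCommGroup X] [NormedSpace ℂ X]
    {Φ Ψ : TraceClass h →L[ℂ] X}
    (hΦ : ∀ w v, Φ (TraceClass.rankOne w v) = Ψ (TraceClass.rankOne w v))
    {ρ : TraceClass h} (hρ : ρ ∈ finiteRankClosure h) : Φ ρ = Ψ ρ := by
  refine ContinuousLinearMap.eqOn_closure_span ?_ hρ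
  rintro _ ⟨w, _, v, _, rfl⟩
  exact hΦ w v

lemma map_mem_finiteRankClosure {Φ : TraceClass h →L[ℂ] TraceClass h}
    (hΦ : ∀ w v, Φ (TraceClass.rankOne w v) ∈ finiteRankClosure h)
    {ρ : TraceClass h} (hρ : ρ ∈ finiteRankClosure h) : Φ ρ ∈ finiteRankClosure h := by
  have hcl : IsClosed (finiteRankClosure h : Set (TraceClass h)) :=
    Submodule.isClosed_topologicalClosure _
  have h1 : ∀ σ ∈ rankOneSpan (⊤ : Submodule ℂ h), Φ σ ∈ finiteRankClosure h := fun σ hσ => by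
    induction hσ using Submodule.span_induction with
    | mem x hx => obtain ⟨w, _, v, _, rfl⟩ := hx; exact hΦ w v
    | zero => rw [map_zero]; exact Submodule.zero_mem _
    | add x y _ _ hx hy => rw [map_add]; exact Submodule.add_mem _ hx hy
    | smul c x _ hx => rw [map_smul]; exact Submodule.smul_mem _ c hx
  exact hcl.closure_subset (map_mem_closure Φ.continuous hρ h1)

lemma channel_mem_finiteRankClosure (Ω : H) (A : HTensor h H →L[ℂ] HTensor h H)
    {ρ : TraceClass h} (hρ : ρ ∈ finiteRankClosure h) : channel Ω A ρ ∈ finiteRankClosure h := by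
  refine map_mem_finiteRankClosure (fun w v => ?_) hρ
  have hcl : IsClosed (finiteRankClosure h : Set (TraceClass h)) :=
    Submodule.isClosed_topologicalClosure _
  exact hcl.mem_of_tendsto (hasSum_channel_rankOne Ω A w v) (Eventually.of_forall fun s =>
    Submodule.sum_mem _ fun j _ => rankOne_mem_finiteRankClosure _ _)

lemma norm_tmulRight_le {Ω : H} (hΩ : ‖Ω‖ = 1) : ‖tmulRight h Ω‖ ≤ 1 :=
  ContinuousLinearMap.opNorm_le_bound _ zero_le_one fun u => by
    rw [tmulRight_apply, norm_tmul, hΩ, mul_one, one_mul]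

lemma norm_sandwich_le {E F : Type*} [NormedAddCommGroup E] [InnerProductSpace ℂ E]
    [CompleteSpace E] [NormedAddCommGroup F] [InnerProductSpace ℂ F] [CompleteSpace F]
    (V : E →L[ℂ] F) (hV : ‖V‖ ≤ 1) : ‖TraceClass.sandwich V‖ ≤ 1 :=
  (LinearMap.mkContinuous_norm_le _ (sq_nonneg _) _).trans
    (pow_le_one₀ (norm_nonneg _) hV)

lemma norm_channel_le {Ω : H} (hΩ : ‖Ω‖ = 1) {A : HTensor h H →L[ℂ] HTensor h H}
    (hA : ‖A‖ ≤ 1) : ‖channel Ω A‖ ≤ 1 := by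
  have hp : ‖(ptrace : TraceClass (HTensor h H) →L[ℂ] TraceClass h)‖ ≤ 1 :=
    LinearMap.mkContinuous_norm_le _ zero_le_one _
  refine (ContinuousLinearMap.opNorm_comp_le _ _).trans
    (mul_le_one₀ hp (norm_nonneg _) ((ContinuousLinearMap.opNorm_comp_le _ _).trans
      (mul_le_one₀ (norm_sandwich_le _ hA) (norm_nonneg _) ?_)))
  exact norm_sandwich_le _ (norm_tmulRight_le hΩ)

lemma channel_one_rankOne {Ω : H} (hΩ : ‖Ω‖ = 1) (w v : h) :
    channel Ω 1 (TraceClass.rankOne w v) = TraceClass.rankOne w v := by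
  refine TraceClass.ext_inner fun u p => ?_
  have hΩ' : ⟪Ω, Ω⟫_ℂ = 1 := by rw [inner_self_eq_norm_sq_to_K, hΩ]; simp
  rw [inner_channel_rankOne, slice_one_apply, slice_one_apply, inner_smul_left, inner_smul_right,
    hΩ', TraceClass.toOp_rankOne, inner_smul_right, inner_conj_symm, mul_one]

namespace UnitaryIncrementProcess

variable {U : ℝ → ℝ → HTensor h H →L[ℂ] HTensor h H} {Ω : H}

lemma inner_vacuum (hA : UnitaryIncrementProcess U Ω) : ⟪Ω, Ω⟫_ℂ = 1 := by
  rw [inner_self_eq_norm_sq_to_K, hA.norm_vacuum]; simp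

/-- The evolution law at r = s = t = 0 makes `U 0 0` idempotent, and a unitary idempotent is the
identity. -/
lemma zero_eq_one (hA : UnitaryIncrementProcess U Ω) : U 0 0 = 1 := by
  have h1 := hA.evolution 0 0 0 le_rfl le_rfl le_rfl
  have h2 := (Unitary.mem_iff.1 (hA.unitary 0 0 le_rfl le_rfl)).1
  calc U 0 0 = (star (U 0 0) * U 0 0) * U 0 0 := by rw [h2, one_mul]
    _ = star (U 0 0) * (U 0 0 * U 0 0) := mul_assoc _ _ _
    _ = star (U 0 0) * U 0 0 := congrArg (star (U 0 0) * ·) h1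
    _ = 1 := h2

lemma starIf_unitary (hA : UnitaryIncrementProcess U Ω) {s t : ℝ} (hs : 0 ≤ s) (hst : s ≤ t)
    (ε : Bool) : starIf ε (U s t) ∈ _root_.unitary (HTensor h H →L[ℂ] HTensor h H) :=
  starIf_mem_unitary (hA.unitary s t hs hst)

lemma commute_starIf (hA : UnitaryIncrementProcess U Ω) {s₁ t₁ s₂ t₂ : ℝ} (h₁ : 0 ≤ s₁)
    (h₁' : s₁ ≤ t₁) (h₂ : 0 ≤ s₂) (h₂' : s₂ ≤ t₂)
    (hd : Disjoint (Set.Ico s₁ t₁) (Set.Ico s₂ t₂)) (ε ε' : Bool) (u₁ v₁ u₂ v₂ : h) :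
    Commute (slice (starIf ε (U s₁ t₁)) u₁ v₁) (slice (starIf ε' (U s₂ t₂)) u₂ v₂) := by
  have H1 := fun u₁ v₁ u₂ v₂ => hA.commute s₁ t₁ s₂ t₂ h₁ h₁' h₂ h₂' hd u₁ v₁ u₂ v₂
  have H2 := fun u₁ v₁ u₂ v₂ => hA.commute s₂ t₂ s₁ t₁ h₂ h₂' h₁ h₁' hd.symm u₁ v₁ u₂ v₂
  cases ε <;> cases ε' <;> simp only [starIf, Bool.false_eq_true, ↓reduceIte]
  · exact (H1 _ _ _ _).1
  · exact (H1 _ _ _ _).2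
  · exact (H2 _ _ _ _).2.symm
  · have := (H1 v₁ u₁ v₂ u₂).1.star_star
    rwa [ContinuousLinearMap.star_eq_adjoint, ContinuousLinearMap.star_eq_adjoint, adjoint_slice,
      adjoint_slice] at this

lemma incrementProd_pair (a b : ℝ) (ε₁ ε₂ : Bool) (u₁ u₂ v₁ v₂ : h) (ξ : H) :
    incrementProd U (fun _ : Fin 2 => a) (fun _ => b) ![ε₁, ε₂] ![u₁, u₂] ![v₁, v₂] ξ =
      slice (starIf ε₁ (U a b)) u₁ v₁ (slice (starIf ε₂ (U a b)) u₂ v₂ ξ) := by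
  simp [incrementProd, List.ofFn_succ]

lemma incrementProd_single (a b : ℝ) (ε : Bool) (u v : h) (ξ : H) :
    incrementProd U (fun _ : Fin 1 => a) (fun _ => b) ![ε] ![u] ![v] ξ =
      slice (starIf ε (U a b)) u v ξ := by
  simp [incrementProd, List.ofFn_succ]

lemma orderedIn_const {s t : ℝ} (hst : s ≤ t) (n : ℕ) :
    OrderedIn s t (fun _ : Fin n => s) (fun _ => t) :=
  ⟨fun _ => ⟨le_rfl, hst, le_rfl⟩, fun _ _ _ => Or.inl ⟨rfl, rfl⟩⟩

/-- Slices over disjoint intervals are independent in the state `Ω`. -/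
lemma inner_slice_slice (hA : UnitaryIncrementProcess U Ω) {s₁ t₁ s₂ t₂ : ℝ} (h₁ : 0 ≤ s₁)
    (h₁' : s₁ ≤ t₁) (h₂ : 0 ≤ s₂) (h₂' : s₂ ≤ t₂)
    (hd : Disjoint (Set.Ico s₁ t₁) (Set.Ico s₂ t₂)) (ε : Bool) (a b c d p q v w : h) :
    ⟪slice (starIf ε (U s₁ t₁)) a p (slice (starIf ε (U s₂ t₂)) c v Ω),
      slice (starIf ε (U s₁ t₁)) b q (slice (starIf ε (U s₂ t₂)) d w Ω)⟫_ℂ =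
    ⟪slice (starIf ε (U s₁ t₁)) a p Ω, slice (starIf ε (U s₁ t₁)) b q Ω⟫_ℂ *
      ⟪slice (starIf ε (U s₂ t₂)) c v Ω, slice (starIf ε (U s₂ t₂)) d w Ω⟫_ℂ := by
  have hi := hA.independent s₁ t₁ s₂ t₂ h₁ h₁' h₂ h₂' hd 2 2 (fun _ => s₁) (fun _ => t₁)
    (fun _ => s₂) (fun _ => t₂) ![!ε, ε] ![!ε, ε] ![p, b] ![a, q] ![v, d] ![c, w]
    (orderedIn_const h₁' 2) (orderedIn_const h₂' 2)
  simp only [incrementProd_pair] at hi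
  simp only [slice_inner, adjoint_starIf]
  rw [← hi]
  -- Moving the left hand slices across the inner product leaves the order B* A* A B. These two
  -- commutations carry B* past both slices of A, giving the form (A* A)(B* B) to which independence
  -- applies.
  have e1 := fun (ζ : H) => congrArg (fun B : H →L[ℂ] H => B ζ)
    (hA.commute_starIf h₁ h₁' h₂ h₂' hd (!ε) (!ε) p a v c).eq
  have e2 := fun (ζ : H) => congrArg (fun B : H →L[ℂ] H => B ζ)
    (hA.commute_starIf h₁ h₁' h₂ h₂' hd ε (!ε) b q v c).eq
  simp only [mul_apply_eq_comp] at e1 e2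
  rw [← e1, ← e2]

/-- The entries on rank one operators are vacuum moments of two slices over one interval, so
stationarity with two factors suffices. -/
lemma channel_shift (hA : UnitaryIncrementProcess U Ω) {s t : ℝ} (hs : 0 ≤ s) (hst : s ≤ t)
    (ε : Bool) {ρ : TraceClass h} (hρ : ρ ∈ finiteRankClosure h) :
    channel Ω (starIf ε (U s t)) ρ = channel Ω (starIf ε (U 0 (t - s))) ρ := by
  refine eq_on_finiteRankClosure (fun w v => TraceClass.ext_inner fun u p => ?_) hρ
  have := hA.stationary s t hs hst 2 ![!ε, ε] ![v, u] ![p, w]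
  rw [inner_channel_rankOne, inner_channel_rankOne, slice_inner, slice_inner, adjoint_starIf,
    adjoint_starIf]
  simpa only [incrementProd_pair] using this

/-- For U the interval splits at s and the inner factor is the shifted one. Taking adjoints reverses
the order of the evolution law, so for U* it splits at t and the outer factor is shifted; that shift
acts on an output of the first channel, which must again lie in `finiteRankClosure`. -/
lemma channel_add (hA : UnitaryIncrementProcess U Ω) (ε : Bool) {s t : ℝ} (hs : 0 ≤ s)
    (ht : 0 ≤ t) {ρ : TraceClass h} (hρ : ρ ∈ finiteRankClosure h) :
    channel Ω (starIf ε (U 0 (s + t))) ρ =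
      channel Ω (starIf ε (U 0 s)) (channel Ω (starIf ε (U 0 t)) ρ) := by
  cases ε
  · have hd : Disjoint (Set.Ico 0 s) (Set.Ico s (s + t)) := Set.Ico_disjoint_Ico_same
    have hst : s ≤ s + t := by linarith
    have h1 := hA.channel_shift hs hst false hρ
    rw [add_sub_cancel_left] at h1
    rw [← h1]
    refine eq_on_finiteRankClosure (Φ := channel Ω (starIf false (U 0 (s + t))))
      (Ψ := channel Ω (starIf false (U 0 s)) ∘L channel Ω (starIf false (U s (s + t))))
      (fun w v => ?_) hρ
    rw [ContinuousLinearMap.comp_apply, ← channel_comp_rankOne Ω _ _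
      (hA.inner_slice_slice le_rfl hs hs hst hd false)]
    simp only [starIf, Bool.false_eq_true, ↓reduceIte]
    rw [hA.evolution 0 s (s + t) le_rfl hs hst]
  · have hd : Disjoint (Set.Ico t (s + t)) (Set.Ico 0 t) := Set.Ico_disjoint_Ico_same.symm
    have hst : t ≤ s + t := by linarith
    have h1 := hA.channel_shift ht hst true
      (channel_mem_finiteRankClosure Ω (starIf true (U 0 t)) hρ)
    rw [add_sub_cancel_right] at h1
    rw [← h1]
    refine eq_on_finiteRankClosure (Φ := channel Ω (starIf true (U 0 (s + t))))
      (Ψ := channel Ω (starIf true (U t (s + t))) ∘L channel Ω (starIf true (U 0 t)))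
      (fun w v => ?_) hρ
    rw [ContinuousLinearMap.comp_apply, ← channel_comp_rankOne Ω _ _
      (hA.inner_slice_slice ht hst le_rfl ht hd true)]
    simp only [starIf, ↓reduceIte]
    rw [← ContinuousLinearMap.adjoint_comp, hA.evolution 0 t (s + t) le_rfl ht hst]

lemma contractiveOrbit_channel (hA : UnitaryIncrementProcess U Ω) (ε : Bool) {ρ : TraceClass h}
    (hρ : ρ ∈ finiteRankClosure h) :
    ContractiveOrbit (fun t => channel Ω (starIf ε (U 0 t))) ρ where
  norm_le t ht := norm_channel_le hA.norm_vacuum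
    (norm_le_one_of_mem_unitary (hA.starIf_unitary le_rfl ht ε))
  zero := by
    have h1 : starIf ε (U 0 0) = 1 := by
      rw [hA.zero_eq_one]
      cases ε
      · rfl
      · rw [starIf, if_pos rfl, ← ContinuousLinearMap.star_eq_adjoint, star_one]
    rw [h1]
    exact eq_on_finiteRankClosure (Ψ := ContinuousLinearMap.id ℂ _)
      (fun w v => channel_one_rankOne hA.norm_vacuum w v) hρ
  add s t hs ht := hA.channel_add ε hs ht hρ

lemma norm_expSemigroup_le (hA : UnitaryIncrementProcess U Ω) {t : ℝ} (ht : 0 ≤ t) :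
    ‖expSemigroup U Ω t‖ ≤ 1 := by
  have h1 := norm_tmulRight_le (h := h) hA.norm_vacuum
  refine (ContinuousLinearMap.opNorm_comp_le _ _).trans (mul_le_one₀ ?_ (norm_nonneg _)
    ((ContinuousLinearMap.opNorm_comp_le _ _).trans (mul_le_one₀
      (norm_le_one_of_mem_unitary (hA.unitary 0 t le_rfl ht)) (norm_nonneg _) h1)))
  rwa [LinearIsometryEquiv.norm_map]

lemma contractiveOrbit_expSemigroup (hA : UnitaryIncrementProcess U Ω) (v : h) :
    ContractiveOrbit (expSemigroup U Ω) v where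
  norm_le t ht := hA.norm_expSemigroup_le ht
  zero := ext_inner_left ℂ fun u => by
    rw [inner_expSemigroup, hA.zero_eq_one, slice_one_apply, inner_smul_right, hA.inner_vacuum,
      mul_one]
  add s t hs ht := ext_inner_left ℂ fun u => by
    have hst : s ≤ s + t := by linarith
    have hd : Disjoint (Set.Ico 0 s) (Set.Ico s (s + t)) := Set.Ico_disjoint_Ico_same
    -- A basis of `h` is inserted between the two evolutions; first vacuum moments then factor term
    -- by term and resum to T_s T_t.
    have h1 := (innerSL ℂ Ω).hasSum (hasSum_slice_comp (U 0 s) (U s (s + t)) u v Ω)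
    rw [hA.evolution 0 s (s + t) le_rfl hs hst] at h1
    rw [inner_expSemigroup]
    refine (h1.tsum_eq.symm.trans ?_)
    rw [← ContinuousLinearMap.adjoint_inner_left, ← (onb h).tsum_inner_mul_inner]
    refine tsum_congr fun k => ?_
    have hi := hA.independent 0 s s (s + t) le_rfl hs hs hst hd 1 1 (fun _ => 0) (fun _ => s)
      (fun _ => s) (fun _ => s + t) ![false] ![false] ![u] ![onb h k] ![onb h k] ![v]
      (orderedIn_const hs 1) (orderedIn_const hst 1)
    have hstat := hA.stationary s (s + t) hs hst 1 ![false] ![onb h k] ![v]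
    simp only [incrementProd_single, add_sub_cancel_left] at hi hstat
    rw [hstat] at hi
    rw [ContinuousLinearMap.adjoint_inner_left, inner_expSemigroup, inner_expSemigroup]
    exact hi

end UnitaryIncrementProcess

end Increments

/-! ### The scale √t of increments -/

section Asymptotics

open Asymptotics

variable {F : Type*} [NormedAddCommGroup F]

lemma isLittleO_sqrt_of_tendsto {f : ℝ → F}
    (hf : Tendsto (fun t : ℝ => t⁻¹ * ‖f t‖ ^ 2) (𝓝[>] 0) (𝓝 0)) :
    f =o[𝓝[>] 0] (fun t : ℝ => √t) := by
  rw [isLittleO_iff]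
  intro c hc
  filter_upwards [hf.eventually (gt_mem_nhds (show (0 : ℝ) < c ^ 2 by positivity)),
    self_mem_nhdsWithin] with t ht ht0
  have ht0' : (0 : ℝ) < t := ht0
  rw [inv_mul_lt_iff₀ ht0'] at ht
  refine le_of_sq_le_sq ?_ (by positivity)
  rw [mul_pow, Real.norm_of_nonneg (Real.sqrt_nonneg t), Real.sq_sqrt ht0'.le]
  linarith

lemma isBigO_sqrt_of_eventually_le {f : ℝ → F} {C : ℝ}
    (hf : ∀ᶠ t : ℝ in 𝓝[>] 0, t⁻¹ * ‖f t‖ ^ 2 ≤ C) :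
    f =O[𝓝[>] 0] (fun t : ℝ => √t) := by
  refine IsBigO.of_bound (√C) ?_
  filter_upwards [hf, self_mem_nhdsWithin] with t ht ht0
  have ht0' : (0 : ℝ) < t := ht0
  have hC : 0 ≤ C := le_trans (by positivity) ht
  rw [inv_mul_le_iff₀ ht0'] at ht
  refine le_of_sq_le_sq ?_ (by positivity)
  rw [mul_pow, Real.norm_of_nonneg (Real.sqrt_nonneg t), Real.sq_sqrt ht0'.le, Real.sq_sqrt hC]
  linarith

variable [InnerProductSpace ℂ F]

/-- Hence limits of t⁻¹⟨f, g⟩ for functions of size √t depend only on f and g modulo o(√t). -/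
lemma tendsto_inv_mul_inner {f g : ℝ → F} (hf : f =O[𝓝[>] 0] (fun t : ℝ => √t))
    (hg : g =o[𝓝[>] 0] (fun t : ℝ => √t)) :
    Tendsto (fun t : ℝ => (t : ℂ)⁻¹ * ⟪f t, g t⟫_ℂ) (𝓝[>] 0) (𝓝 0) := by
  have h1 : (fun t => ‖f t‖ * ‖g t‖) =o[𝓝[>] 0] (fun t : ℝ => t) :=
    (hf.norm_left.mul_isLittleO hg.norm_left).congr' EventuallyEq.rfl (by
      filter_upwards [self_mem_nhdsWithin] with t ht
      exact Real.mul_self_sqrt (le_of_lt ht))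
  refine squeeze_zero_norm' ?_ h1.tendsto_div_nhds_zero
  filter_upwards [self_mem_nhdsWithin] with t ht
  have ht0 : (0 : ℝ) < t := ht
  rw [norm_mul, norm_inv, Complex.norm_real, Real.norm_of_nonneg ht0.le, div_eq_inv_mul]
  gcongr
  exact norm_inner_le_norm _ _

end Asymptotics

/-! ### Estimates for V - 1 with V unitary -/

section UnitaryDifference

variable {E F : Type*} [NormedAddCommGroup E] [InnerProductSpace ℂ E] [CompleteSpace E]
variable [NormedAddCommGroup F] [InnerProductSpace ℂ F] [CompleteSpace F]

open ContinuousLinearMap (adjoint)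

lemma adjoint_starIf_sub_one (ε : Bool) (A : HTensor E F →L[ℂ] HTensor E F) :
    adjoint (starIf ε A - 1) = starIf (!ε) A - 1 := by
  rw [map_sub, adjoint_starIf, ← ContinuousLinearMap.star_eq_adjoint 1, star_one]

/-- Expanding the square with ‖Vψ‖ = ‖ψ‖ turns a quadratic quantity into one that is linear in V -
1, so moments of one order are bounded by moments of lower order. -/
lemma norm_sub_one_apply_sq {V : HTensor E F →L[ℂ] HTensor E F}
    (hV : V ∈ unitary (HTensor E F →L[ℂ] HTensor E F)) (ψ : HTensor E F) :
    ‖(V - 1) ψ‖ ^ 2 = -2 * (⟪ψ, (V - 1) ψ⟫_ℂ).re := by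
  have h1 : (⟪V ψ, ψ⟫_ℂ).re = (⟪ψ, V ψ⟫_ℂ).re := by
    rw [← inner_conj_symm (𝕜 := ℂ) (V ψ) ψ]
    exact Complex.conj_re _
  have h2 : (⟪ψ, ψ⟫_ℂ).re = ‖ψ‖ ^ 2 := inner_self_eq_norm_sq (𝕜 := ℂ) ψ
  rw [sub_apply, one_apply_eq_self, @norm_sub_sq ℂ, norm_apply_of_mem_unitary hV,
    inner_sub_right, Complex.sub_re, h2, RCLike.re_eq_complex_re, h1]
  ring

lemma norm_starIf_sub_one_apply_sq {V : HTensor E F →L[ℂ] HTensor E F}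
    (hV : V ∈ unitary (HTensor E F →L[ℂ] HTensor E F)) (ε : Bool) (ψ : HTensor E F) :
    ‖(starIf ε V - 1) ψ‖ ^ 2 = -2 * (⟪ψ, (V - 1) ψ⟫_ℂ).re := by
  rw [norm_sub_one_apply_sq (starIf_mem_unitary hV)]
  cases ε
  · rfl
  · congr 1
    have h1 := adjoint_starIf_sub_one false V
    simp only [Bool.not_false] at h1
    rw [← h1, ContinuousLinearMap.adjoint_inner_right, ← inner_conj_symm]
    exact Complex.conj_re _

/-- With ξ = Ω this bounds second moments by first moments. With ξ an increment of Ω the right side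
is a third moment, to which the Gaussian condition applies. -/
lemma norm_slice_sub_one_sq_le {V : HTensor E F →L[ℂ] HTensor E F}
    (hV : V ∈ unitary (HTensor E F →L[ℂ] HTensor E F)) (ε : Bool) (u v : E) (ξ : F) :
    ‖slice (starIf ε V - 1) u v ξ‖ ^ 2 ≤ ‖u‖ ^ 2 * (-2 * (⟪ξ, slice (V - 1) v v ξ⟫_ℂ).re) := by
  rw [inner_slice, ← norm_starIf_sub_one_apply_sq hV ε, ← mul_pow]
  exact pow_le_pow_left₀ (norm_nonneg _) (norm_contract_le _ _) 2

lemma norm_starIf_sub_one_le {V : HTensor E F →L[ℂ] HTensor E F}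
    (hV : V ∈ unitary (HTensor E F →L[ℂ] HTensor E F)) (ε : Bool) (ψ : HTensor E F) :
    ‖(starIf ε V - 1) ψ‖ ≤ 2 * ‖ψ‖ := by
  rw [sub_apply, one_apply_eq_self]
  refine (norm_sub_le _ _).trans ?_
  rw [norm_apply_of_mem_unitary (starIf_mem_unitary hV)]
  linarith

lemma norm_slice_sub_one_le {V : HTensor E F →L[ℂ] HTensor E F}
    (hV : V ∈ unitary (HTensor E F →L[ℂ] HTensor E F)) (ε : Bool) (u v : E) (ξ : F) :
    ‖slice (starIf ε V - 1) u v ξ‖ ≤ ‖u‖ * (2 * ‖v‖) * ‖ξ‖ := by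
  have h1 := norm_starIf_sub_one_le hV ε (tmul v ξ)
  rw [norm_tmul] at h1
  rw [slice_apply]
  calc ‖contract F u ((starIf ε V - 1) (tmul v ξ))‖ ≤ ‖u‖ * (2 * (‖v‖ * ‖ξ‖)) :=
        (norm_contract_le _ _).trans (mul_le_mul_of_nonneg_left h1 (norm_nonneg u))
    _ = _ := by ring

/-- For unitary `V`, `(V - 1) + (V* - 1) = -(V* - 1) (V - 1)`. -/
lemma sub_one_add_adjoint_sub_one {V : HTensor E F →L[ℂ] HTensor E F}
    (hV : V ∈ unitary (HTensor E F →L[ℂ] HTensor E F)) (ψ : HTensor E F) :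
    (V - 1) ψ + (adjoint V - 1) ψ = -((adjoint V - 1) ((V - 1) ψ)) := by
  have h1 : adjoint V (V ψ) = ψ := by
    have := congrArg (fun B : HTensor E F →L[ℂ] HTensor E F => B ψ) (Unitary.mem_iff.1 hV).1
    rw [ContinuousLinearMap.star_eq_adjoint] at this
    exact this
  simp only [sub_apply, one_apply_eq_self, map_sub, h1]
  abel

/-- Expand (A - 1)(·)(A - 1)*: each cross term contains A once, so only the vacuum expectation S of
A enters. It serves A = U_t with S = T_t and A = U_t* with S = T_t*. -/
lemma channel_sub_one_rankOne {Ω : F} (hΩ : ⟪Ω, Ω⟫_ℂ = 1) (A : HTensor E F →L[ℂ] HTensor E F)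
    {S : E →L[ℂ] E} (hS : ∀ u v, ⟪u, S v⟫_ℂ = ⟪Ω, slice A u v Ω⟫_ℂ) (w v : E) :
    channel Ω (A - 1) (TraceClass.rankOne w v) =
      channel Ω A (TraceClass.rankOne w v) - TraceClass.rankOne w v
        - TraceClass.rankOne (S w - w) v - TraceClass.rankOne w (S v - v) := by
  refine TraceClass.ext_inner fun u p => ?_
  have hS' : ⟪slice A p v Ω, Ω⟫_ℂ = ⟪S v, p⟫_ℂ := by
    rw [← inner_conj_symm, ← hS, inner_conj_symm]
  simp only [map_sub, sub_apply, inner_sub_right, inner_channel_rankOne, slice_sub, inner_sub_left,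
    slice_one_apply, inner_smul_left, inner_smul_right, hΩ, TraceClass.toOp_rankOne, hS', ← hS,
    inner_conj_symm]
  ring

end UnitaryDifference

/-! ### Sizes of increments and the relation between U - 1 and U* - 1 -/

section Increments

variable {h H : Type*} [NormedAddCommGroup h] [InnerProductSpace ℂ h] [CompleteSpace h]
variable [NormedAddCommGroup H] [InnerProductSpace ℂ H] [CompleteSpace H]
variable {U : ℝ → ℝ → HTensor h H →L[ℂ] HTensor h H} {Ω : H}

open ContinuousLinearMap (adjoint)
open Asymptotics

/-- Products of two increments are `o(√t)` in the state `Ω`. -/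
lemma isLittleO_slice_slice (hA : UnitaryIncrementProcess U Ω) (hC : Gaussian U Ω)
    (ε ε' : Bool) (u v p w : h) :
    (fun t => slice (starIf ε (U 0 t) - 1) u v (slice (starIf ε' (U 0 t) - 1) p w Ω))
      =o[𝓝[>] 0] (fun t : ℝ => √t) := by
  refine isLittleO_sqrt_of_tendsto ?_
  -- The outer factors are the inner increment and its adjoint; the middle one is the diagonal slice
  -- (v, v) left over when the square of the outer slice is estimated by a term linear in U - 1.
  have h1 := ((hC w p v v p w (!ε') false ε').norm).const_mul (‖u‖ ^ 2 * 2)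
  rw [norm_zero, mul_zero] at h1
  refine squeeze_zero' ?_ ?_ h1
  · filter_upwards [self_mem_nhdsWithin] with t ht
    have ht0 : (0 : ℝ) < t := ht
    positivity
  filter_upwards [self_mem_nhdsWithin] with t ht
  have ht0 : (0 : ℝ) < t := ht
  have h2 := norm_slice_sub_one_sq_le (hA.unitary 0 t le_rfl ht0.le) ε u v
    (slice (starIf ε' (U 0 t) - 1) p w Ω)
  rw [slice_inner, adjoint_starIf_sub_one] at h2
  rw [norm_mul, norm_inv, Complex.norm_real, Real.norm_of_nonneg ht0.le, mul_left_comm]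
  gcongr
  refine h2.trans ?_
  rw [mul_assoc]
  refine mul_le_mul_of_nonneg_left ?_ (by positivity)
  have h3 := Complex.abs_re_le_norm (⟪Ω, slice (starIf (!ε') (U 0 t) - 1) w p
    (slice (U 0 t - 1) v v (slice (starIf ε' (U 0 t) - 1) p w Ω))⟫_ℂ)
  have h4 := neg_abs_le (⟪Ω, slice (starIf (!ε') (U 0 t) - 1) w p
    (slice (U 0 t - 1) v v (slice (starIf ε' (U 0 t) - 1) p w Ω))⟫_ℂ).re
  change _ ≤ 2 * ‖⟪Ω, slice (starIf (!ε') (U 0 t) - 1) w p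
    (slice (U 0 t - 1) v v (slice (starIf ε' (U 0 t) - 1) p w Ω))⟫_ℂ‖
  linarith

lemma inner_slice_sub_one (hA : UnitaryIncrementProcess U Ω) (t : ℝ) (u v : h) :
    ⟪Ω, slice (U 0 t - 1) u v Ω⟫_ℂ = ⟪u, expSemigroup U Ω t v - v⟫_ℂ := by
  rw [slice_sub, sub_apply, inner_sub_right, inner_sub_right, ← inner_expSemigroup,
    slice_one_apply, inner_smul_right, hA.inner_vacuum, mul_one]

/-- For v ∈ D(G) the first moment ⟨v, (T_t - 1)v⟩ is O(t), and by unitarity it bounds the second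
moments of both U - 1 and U* - 1. -/
lemma isBigO_slice (hA : UnitaryIncrementProcess U Ω) {v : h} (hv : v ∈ (genG U Ω).domain)
    (ε : Bool) (u : h) :
    (fun t => slice (starIf ε (U 0 t) - 1) u v Ω) =O[𝓝[>] 0] (fun t : ℝ => √t) := by
  obtain ⟨y, hy⟩ := hv
  have h1 : Tendsto (fun t : ℝ => ‖u‖ ^ 2 * (2 * (‖v‖ * ‖(t : ℂ)⁻¹ • (expSemigroup U Ω t v - v)‖)))
      (𝓝[>] 0) (𝓝 (‖u‖ ^ 2 * (2 * (‖v‖ * ‖y‖)))) :=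
    (((Tendsto.norm hy).const_mul ‖v‖).const_mul 2).const_mul _
  refine isBigO_sqrt_of_eventually_le (C := ‖u‖ ^ 2 * (2 * (‖v‖ * ‖y‖)) + 1) ?_
  filter_upwards [h1.eventually (ge_mem_nhds (lt_add_one _)), self_mem_nhdsWithin] with t ht ht0
  have ht0' : (0 : ℝ) < t := ht0
  refine le_trans ?_ ht
  have h2 := norm_slice_sub_one_sq_le (hA.unitary 0 t le_rfl ht0'.le) ε u v Ω
  rw [inner_slice_sub_one hA] at h2
  have h3 := (Complex.abs_re_le_norm ⟪v, expSemigroup U Ω t v - v⟫_ℂ).trans (norm_inner_le_norm _ _)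
  have h4 := neg_abs_le (⟪v, expSemigroup U Ω t v - v⟫_ℂ).re
  rw [norm_smul, norm_inv, Complex.norm_real, Real.norm_of_nonneg ht0'.le]
  calc t⁻¹ * ‖slice (starIf ε (U 0 t) - 1) u v Ω‖ ^ 2
      ≤ t⁻¹ * (‖u‖ ^ 2 * (2 * (‖v‖ * ‖expSemigroup U Ω t v - v‖))) := by
        gcongr
        refine h2.trans (mul_le_mul_of_nonneg_left ?_ (by positivity))
        linarith
    _ = _ := by ring

lemma TraceClass.rankOne_smul_left (c : ℂ) (a b : h) :
    TraceClass.rankOne (c • a) b = c • TraceClass.rankOne a b :=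
  TraceClass.ext_inner fun u p => by simp; ring

lemma TraceClass.rankOne_smul_right (c : ℂ) (a b : h) :
    TraceClass.rankOne a (c • b) = (starRingEnd ℂ) c • TraceClass.rankOne a b :=
  TraceClass.ext_inner fun u p => by simp; ring

/-- The limit of `t⁻¹ Tr_H[(U_t - 1) (|w⟩⟨v| ⊗ |Ω⟩⟨Ω|) (U_t - 1)*]`. -/
lemma tendsto_channel_sub_one (hA : UnitaryIncrementProcess U Ω) {v w gv gw : h}
    {L : TraceClass h} (hv : HasGenerator (expSemigroup U Ω) v gv)
    (hw : HasGenerator (expSemigroup U Ω) w gw)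
    (hL : HasGenerator (semigroupZ U Ω) (TraceClass.rankOne w v) L) :
    Tendsto (fun t : ℝ => (t : ℂ)⁻¹ • channel Ω (U 0 t - 1) (TraceClass.rankOne w v)) (𝓝[>] 0)
      (𝓝 (L - TraceClass.rankOne gw v - TraceClass.rankOne w gv)) := by
  refine ((Tendsto.sub hL (TraceClass.tendsto_rankOne_left hw v)).sub
    (TraceClass.tendsto_rankOne_right hv w)).congr fun t => ?_
  rw [channel_sub_one_rankOne hA.inner_vacuum (U 0 t) (inner_expSemigroup U Ω t), semigroupZ_eq,
    TraceClass.rankOne_smul_left, TraceClass.rankOne_smul_right, map_inv₀, Complex.conj_ofReal]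
  simp only [smul_sub]

/-- On product vectors the increments of `U*` and `-U` agree up to `o(√t)`. -/
lemma isLittleO_slice_add_slice_adjoint (hA : UnitaryIncrementProcess U Ω) (hC : Gaussian U Ω)
    {v : h} {R : TraceClass h}
    (hR : Tendsto (fun t : ℝ => (t : ℂ)⁻¹ • channel Ω (U 0 t - 1) (TraceClass.rankOne v v)) (𝓝[>] 0)
      (𝓝 R)) (u : h) :
    (fun t => slice (U 0 t - 1) u v Ω + slice (adjoint (U 0 t) - 1) u v Ω)
      =o[𝓝[>] 0] (fun t : ℝ => √t) := by
  set X : ℝ → HTensor h H := fun t => (U 0 t - 1) (tmul v Ω) with hX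
  -- Choose s so that the diagonal entries of R outside s sum to less than δ². That sum is a bounded
  -- functional Φ of the operator, and t⁻¹ times the squared truncation error of X is Φ at t⁻¹ times
  -- the channel output, which tends to Φ(R).
  have htail : ∀ δ : ℝ, 0 < δ → ∃ s, ∀ᶠ t : ℝ in 𝓝[>] 0,
      ‖X t - truncate (onb h) s (X t)‖ ≤ δ * √t := by
    intro δ hδ
    have hsum : HasSum (fun k => TraceClass.entry (onb h k) (onb h k) R)
        (TraceClass.tracePair 1 R) := by
      have := (TraceClass.summable_inner_onb 1 R).hasSum
      rw [← ContinuousLinearMap.star_eq_adjoint, star_one] at this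
      rw [TraceClass.tracePair_apply, ← ContinuousLinearMap.star_eq_adjoint, star_one]
      simpa only [one_apply_eq_self, TraceClass.entry_apply] using this
    rw [HasSum, SummationFilter.unconditional_filter, tendsto_iff_norm_sub_tendsto_zero] at hsum
    obtain ⟨s, hs⟩ := (hsum.eventually (gt_mem_nhds (show (0 : ℝ) < δ ^ 2 by positivity))).exists
    refine ⟨s, ?_⟩
    set Φ : TraceClass h →L[ℂ] ℂ :=
      TraceClass.tracePair 1 - ∑ k ∈ s, TraceClass.entry (onb h k) (onb h k) with hΦ
    have hΦR : ‖Φ R‖ < δ ^ 2 := by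
      rw [norm_sub_rev] at hs
      simpa [hΦ, sum_apply] using hs
    have hΦX : ∀ t, Φ (channel Ω (U 0 t - 1) (TraceClass.rankOne v v)) =
        ((‖X t - truncate (onb h) s (X t)‖ ^ 2 : ℝ) : ℂ) := fun t => by
      rw [norm_sub_truncate_sq, hΦ, sub_apply, tracePair_one_channel_rankOne, sum_apply]
      push_cast
      congr 1
      refine Finset.sum_congr rfl fun k _ => ?_
      rw [TraceClass.entry_apply, inner_channel_rankOne, inner_self_eq_norm_sq_to_K, slice_apply]
      rfl
    have hlim := ((Φ.continuous.tendsto R).comp hR).norm.eventually (gt_mem_nhds hΦR)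
    filter_upwards [hlim, self_mem_nhdsWithin] with t ht ht0
    have ht0' : (0 : ℝ) < t := ht0
    rw [Function.comp_apply, map_smul, hΦX, smul_eq_mul, norm_mul, norm_inv, Complex.norm_real,
      Complex.norm_real, Real.norm_of_nonneg ht0'.le, Real.norm_of_nonneg (sq_nonneg _),
      inv_mul_lt_iff₀ ht0'] at ht
    refine le_of_sq_le_sq ?_ (by positivity)
    rw [mul_pow, Real.sq_sqrt ht0'.le]
    linarith
  refine IsLittleO.of_bound fun c hc => ?_
  -- Applying U* - 1 costs a factor 2 and the contraction with u costs ‖u‖; the extra 1 keeps the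
  -- denominator positive, and half of c remains for the finite sum.
  obtain ⟨s, hs⟩ := htail (c / (2 * (2 * ‖u‖ + 1))) (by positivity)
  have hfin : (fun t => ∑ k ∈ s, slice (starIf true (U 0 t) - 1) u (onb h k)
      (slice (starIf false (U 0 t) - 1) (onb h k) v Ω)) =o[𝓝[>] 0] (fun t : ℝ => √t) :=
    IsLittleO.fun_sum fun k _ => isLittleO_slice_slice hA hC true false u (onb h k) (onb h k) v
  filter_upwards [hs, hfin.bound (show 0 < c / 2 by positivity), self_mem_nhdsWithin]
    with t ht1 ht2 ht0
  have ht0' : (0 : ℝ) < t := ht0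
  have hU := hA.unitary 0 t le_rfl ht0'.le
  -- The product (U* - 1)(U - 1) is split by a truncation in between: the truncated part is a finite
  -- sum of products of two slices, and the remainder is the tail.
  have h1 : slice (U 0 t - 1) u v Ω + slice (adjoint (U 0 t) - 1) u v Ω =
      -(contract H u ((adjoint (U 0 t) - 1) (X t - truncate (onb h) s (X t))) +
        ∑ k ∈ s, slice (starIf true (U 0 t) - 1) u (onb h k)
          (slice (starIf false (U 0 t) - 1) (onb h k) v Ω)) := by
    rw [slice_apply, slice_apply, ← map_add, sub_one_add_adjoint_sub_one hU, map_neg,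
      map_sub, map_sub, truncate_apply, map_sum, map_sum]
    congr 1
    exact (sub_add_cancel _ _).symm
  have h2 : ‖contract H u ((adjoint (U 0 t) - 1) (X t - truncate (onb h) s (X t)))‖ ≤
      ‖u‖ * (2 * (c / (2 * (2 * ‖u‖ + 1)) * √t)) := by
    refine (norm_contract_le _ _).trans ?_
    gcongr
    exact (norm_starIf_sub_one_le hU true _).trans (by gcongr)
  have h3 : ‖u‖ * (2 * (c / (2 * (2 * ‖u‖ + 1)) * √t)) ≤ c / 2 * √t := by
    have : ‖u‖ * (2 * (c / (2 * (2 * ‖u‖ + 1)) * √t)) =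
        (2 * ‖u‖ / (2 * ‖u‖ + 1)) * (c / 2 * √t) := by field_simp
    rw [this]
    refine mul_le_of_le_one_left (by positivity) ?_
    rw [div_le_one (by positivity)]
    linarith
  rw [Real.norm_of_nonneg (Real.sqrt_nonneg t)] at ht2 ⊢
  rw [h1, norm_neg]
  refine (norm_add_le _ _).trans ?_
  linarith

end Increments

/-! ### Existence, positivity and U ↔ U* symmetry of the noise kernel -/

section NoiseKernel

variable {h H : Type*} [NormedAddCommGroup h] [InnerProductSpace ℂ h] [CompleteSpace h]
variable [NormedAddCommGroup H] [InnerProductSpace ℂ H] [CompleteSpace H]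
variable {U : ℝ → ℝ → HTensor h H →L[ℂ] HTensor h H} {Ω : H} {𝒟 : Submodule ℂ h}

open ContinuousLinearMap (adjoint)
open Asymptotics

namespace CoreAssumption

lemma rankOne_mem_domain_Z (hE : CoreAssumption U Ω 𝒟) (w v : 𝒟) :
    TraceClass.rankOne (w : h) (v : h) ∈ (generator (semigroupZ U Ω)).domain :=
  hE.core_Z.le_domain (Submodule.subset_span ⟨w, w.2, v, v.2, rfl⟩)

lemma rankOne_mem_domain_F (hE : CoreAssumption U Ω 𝒟) (w v : 𝒟) :
    TraceClass.rankOne (w : h) (v : h) ∈ (generator (semigroupF U Ω)).domain :=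
  hE.core_F.le_domain (Submodule.subset_span ⟨w, w.2, v, v.2, rfl⟩)

/-- The noise part `ℒ(|w⟩⟨v|) - |Gw⟩⟨v| - |w⟩⟨Gv|` of the generator of `Z`. -/
def noiseOp (hE : CoreAssumption U Ω 𝒟) (w v : 𝒟) : TraceClass h :=
  generator (semigroupZ U Ω) ⟨_, hE.rankOne_mem_domain_Z w v⟩
    - TraceClass.rankOne (restrictTo (genG U Ω) hE.le_domain w) (v : h)
    - TraceClass.rankOne (w : h) (restrictTo (genG U Ω) hE.le_domain v)

lemma hasGenerator_G (hE : CoreAssumption U Ω 𝒟) (v : 𝒟) :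
    HasGenerator (expSemigroup U Ω) v (restrictTo (genG U Ω) hE.le_domain v) :=
  generator_apply (T := expSemigroup U Ω) ⟨v, hE.le_domain v.2⟩

lemma tendsto_noiseOp (hE : CoreAssumption U Ω 𝒟) (hA : UnitaryIncrementProcess U Ω) (w v : 𝒟) :
    Tendsto (fun t : ℝ => (t : ℂ)⁻¹ • channel Ω (U 0 t - 1) (TraceClass.rankOne (w : h) (v : h)))
      (𝓝[>] 0) (𝓝 (hE.noiseOp w v)) :=
  tendsto_channel_sub_one hA (hE.hasGenerator_G v) (hE.hasGenerator_G w)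
    (generator_apply (T := semigroupZ U Ω) ⟨_, hE.rankOne_mem_domain_Z w v⟩)

lemma tendsto_inner_slice (hE : CoreAssumption U Ω 𝒟) (hA : UnitaryIncrementProcess U Ω)
    (w v : 𝒟) (u p : h) :
    Tendsto (fun t : ℝ => (t : ℂ)⁻¹ * ⟪slice (U 0 t - 1) p v Ω, slice (U 0 t - 1) u w Ω⟫_ℂ)
      (𝓝[>] 0) (𝓝 ⟪u, TraceClass.toOp h (hE.noiseOp w v) p⟫_ℂ) := by
  refine (((TraceClass.entry u p).continuous.tendsto _).comp
    (hE.tendsto_noiseOp hA w v)).congr fun t => ?_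
  rw [Function.comp_apply, map_smul, TraceClass.entry_apply, inner_channel_rankOne, smul_eq_mul]

end CoreAssumption

variable (U Ω 𝒟) in
/-- The `H`-valued functions of `t` that up to `o(√t)` are combinations of the increments
`(U_t - 1)(u, v) Ω` with `v ∈ 𝒟`. -/
def incrementGerms : Submodule ℂ (ℝ → H) :=
  Submodule.span ℂ ({f | ∃ (u : h) (v : 𝒟), f = fun t => slice (U 0 t - 1) u v Ω} ∪
    {f | f =o[𝓝[>] 0] (fun t : ℝ => √t)})

lemma mem_incrementGerms_of_isLittleO {f : ℝ → H} (hf : f =o[𝓝[>] 0] (fun t : ℝ => √t)) :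
    f ∈ incrementGerms U Ω 𝒟 :=
  Submodule.subset_span (Or.inr hf)

lemma slice_mem_incrementGerms (hA : UnitaryIncrementProcess U Ω) (hC : Gaussian U Ω)
    (hE : CoreAssumption U Ω 𝒟) (ε : Bool) (u : h) (v : 𝒟) :
    (fun t => slice (starIf ε (U 0 t) - 1) u v Ω) ∈ incrementGerms U Ω 𝒟 := by
  have h1 : (fun t => slice (U 0 t - 1) u (v : h) Ω) ∈ incrementGerms U Ω 𝒟 :=
    Submodule.subset_span (Or.inl ⟨u, v, rfl⟩)
  cases ε
  · exact h1
  · have h2 := mem_incrementGerms_of_isLittleO (U := U) (Ω := Ω) (𝒟 := 𝒟)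
      (isLittleO_slice_add_slice_adjoint hA hC (hE.tendsto_noiseOp hA v v) u)
    convert Submodule.sub_mem _ h2 h1 using 1
    ext t
    simp [starIf]

lemma isBigO_of_mem_incrementGerms (hA : UnitaryIncrementProcess U Ω)
    (hE : CoreAssumption U Ω 𝒟) {f : ℝ → H} (hf : f ∈ incrementGerms U Ω 𝒟) :
    f =O[𝓝[>] 0] (fun t : ℝ => √t) := by
  induction hf using Submodule.span_induction with
  | mem f hf =>
    rcases hf with ⟨u, v, rfl⟩ | hf
    · exact isBigO_slice hA (hE.le_domain v.2) false u
    · exact hf.isBigO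
  | zero => exact isBigO_zero _ _
  | add f g _ _ hf hg => exact hf.add hg
  | smul c f _ hf => exact hf.const_smul_left c

lemma isLittleO_slice_of_mem_incrementGerms (hA : UnitaryIncrementProcess U Ω)
    (hC : Gaussian U Ω) (ε : Bool) (u v : h) {f : ℝ → H} (hf : f ∈ incrementGerms U Ω 𝒟) :
    (fun t => slice (starIf ε (U 0 t) - 1) u v (f t)) =o[𝓝[>] 0] (fun t : ℝ => √t) := by
  induction hf using Submodule.span_induction with
  | mem f hf =>
    rcases hf with ⟨p, w, rfl⟩ | hf
    · exact isLittleO_slice_slice hA hC ε false u v p w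
    · refine IsBigO.trans_isLittleO (IsBigO.of_bound (‖u‖ * (2 * ‖v‖)) ?_) hf
      filter_upwards [self_mem_nhdsWithin] with t ht
      exact norm_slice_sub_one_le (hA.unitary 0 t le_rfl (le_of_lt ht)) ε u v _
  | zero => simp
  | add f g _ _ hf hg => simpa using hf.add hg
  | smul c f _ hf =>
    refine (hf.const_smul_left c).congr_left fun t => ?_
    simp

/-- By linearity in each argument it is enough to pair generators of the span: two increments of U
converge to an entry of `noiseOp`, and a pair with an o(√t) member tends to 0. -/
lemma exists_tendsto_inner_of_mem_incrementGerms (hA : UnitaryIncrementProcess U Ω)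
    (hE : CoreAssumption U Ω 𝒟) {f g : ℝ → H} (hf : f ∈ incrementGerms U Ω 𝒟)
    (hg : g ∈ incrementGerms U Ω 𝒟) :
    ∃ ℓ : ℂ, Tendsto (fun t : ℝ => (t : ℂ)⁻¹ * ⟪f t, g t⟫_ℂ) (𝓝[>] 0) (𝓝 ℓ) := by
  have hsymm : ∀ f g : ℝ → H,
      (∃ ℓ : ℂ, Tendsto (fun t : ℝ => (t : ℂ)⁻¹ * ⟪f t, g t⟫_ℂ) (𝓝[>] 0) (𝓝 ℓ)) →
      ∃ ℓ : ℂ, Tendsto (fun t : ℝ => (t : ℂ)⁻¹ * ⟪g t, f t⟫_ℂ) (𝓝[>] 0) (𝓝 ℓ) := by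
    rintro f g ⟨ℓ, hℓ⟩
    refine ⟨_, ((Complex.continuous_conj.tendsto ℓ).comp hℓ).congr fun t => ?_⟩
    simp
  have hlin : ∀ f : ℝ → H, (∀ g, ((∃ (u : h) (v : 𝒟), g = fun t => slice (U 0 t - 1) u v Ω) ∨
        g =o[𝓝[>] 0] (fun t : ℝ => √t)) →
        ∃ ℓ : ℂ, Tendsto (fun t : ℝ => (t : ℂ)⁻¹ * ⟪f t, g t⟫_ℂ) (𝓝[>] 0) (𝓝 ℓ)) →
      ∀ g ∈ incrementGerms U Ω 𝒟,
        ∃ ℓ : ℂ, Tendsto (fun t : ℝ => (t : ℂ)⁻¹ * ⟪f t, g t⟫_ℂ) (𝓝[>] 0) (𝓝 ℓ) := by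
    intro f H1 g hg
    induction hg using Submodule.span_induction with
    | mem g hg => exact H1 g hg
    | zero => exact ⟨0, by simp⟩
    | add g g' _ _ hg hg' =>
      obtain ⟨ℓ, hℓ⟩ := hg
      obtain ⟨ℓ', hℓ'⟩ := hg'
      exact ⟨_, (hℓ.add hℓ').congr fun t => by rw [Pi.add_apply, inner_add_right, mul_add]⟩
    | smul c g _ hg =>
      obtain ⟨ℓ, hℓ⟩ := hg
      exact ⟨_, (hℓ.const_mul c).congr fun t => by
        rw [Pi.smul_apply, inner_smul_right, mul_left_comm]⟩
  refine hlin f (fun g hg' => ?_) g hg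
  rcases hg' with ⟨u, w, rfl⟩ | hg'
  · refine hsymm _ _ (hlin _ (fun f hf' => ?_) f hf)
    rcases hf' with ⟨p, v, rfl⟩ | hf'
    · exact ⟨_, hE.tendsto_inner_slice hA v w p u⟩
    · exact ⟨0, tendsto_inv_mul_inner (isBigO_slice hA (hE.le_domain w.2) false u) hf'⟩
  · exact ⟨0, tendsto_inv_mul_inner (isBigO_of_mem_incrementGerms hA hE hf) hg'⟩

/-- Write a word as a letter A(u, v) times a word X whose scalar product is c. Then A(u, v)XΩ - ⟨u,
v⟩cΩ is the sum of (A - 1)(u, v)(X - c)Ω, of c(A - 1)(u, v)Ω and of ⟨u, v⟩(X - c)Ω. By induction the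
first is o(√t) and the last is an increment germ. Longer words thus bring nothing beyond first order
increments. -/
lemma wordVec_mem_incrementGerms (hA : UnitaryIncrementProcess U Ω) (hC : Gaussian U Ω)
    (hE : CoreAssumption U Ω 𝒟) (l : Word 𝒟) :
    (fun t => wordVec U Ω t l) ∈ incrementGerms U Ω 𝒟 := by
  obtain ⟨l, hl⟩ := l
  -- Nonemptiness is dropped so that the induction can start from the empty word, which contributes
  -- 0.
  have key : ∀ l : List (h × 𝒟 × Bool),
      (fun t => (l.map fun x => slice (starIf x.2.2 (U 0 t)) x.1 (x.2.1 : h)).prod Ω -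
    (l.map fun x => ⟪x.1, (x.2.1 : h)⟫_ℂ).prod • Ω) ∈ incrementGerms U Ω 𝒟 := fun l => by
    induction l with
    | nil =>
      convert Submodule.zero_mem (incrementGerms U Ω 𝒟) using 1
      ext t
      simp
    | cons x l ih =>
      obtain ⟨u, v, ε⟩ := x
      set f : ℝ → H := fun t => (l.map fun x => slice (starIf x.2.2 (U 0 t)) x.1 (x.2.1 : h)).prod Ω -
        (l.map fun x => ⟪x.1, (x.2.1 : h)⟫_ℂ).prod • Ω with hf
      set c : ℂ := (l.map fun x => ⟪x.1, (x.2.1 : h)⟫_ℂ).prod with hc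
      have h1 := mem_incrementGerms_of_isLittleO (U := U) (Ω := Ω) (𝒟 := 𝒟)
        (isLittleO_slice_of_mem_incrementGerms hA hC ε u v ih)
      have h2 := Submodule.smul_mem _ c (slice_mem_incrementGerms hA hC hE ε u v)
      have h3 := Submodule.smul_mem _ ⟪u, (v : h)⟫_ℂ ih
      convert Submodule.add_mem _ (Submodule.add_mem _ h1 h2) h3 using 1
      ext t
      simp only [List.map_cons, List.prod_cons, mul_apply_eq_comp, Pi.add_apply, Pi.smul_apply,
        slice_sub, sub_apply, slice_one_apply, hf, map_sub, map_smul, smul_sub, smul_smul,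
        ← hc, mul_comm c]
      abel
  exact key l

/-- The limit exists, so `limUnder` does not take its default value. -/
lemma tendsto_noiseKernel (hA : UnitaryIncrementProcess U Ω) (hC : Gaussian U Ω)
    (hE : CoreAssumption U Ω 𝒟) (l l' : Word 𝒟) :
    Tendsto (fun t : ℝ => (t : ℂ)⁻¹ * ⟪wordVec U Ω t l, wordVec U Ω t l'⟫_ℂ) (𝓝[>] 0)
      (𝓝 (noiseKernel U Ω l l')) := by
  obtain ⟨ℓ, hℓ⟩ := exists_tendsto_inner_of_mem_incrementGerms hA hE
    (wordVec_mem_incrementGerms hA hC hE l) (wordVec_mem_incrementGerms hA hC hE l')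
  rw [noiseKernel, hℓ.limUnder_eq]
  exact hℓ

lemma conj_noiseKernel (hA : UnitaryIncrementProcess U Ω) (hC : Gaussian U Ω)
    (hE : CoreAssumption U Ω 𝒟) (l l' : Word 𝒟) :
    (starRingEnd ℂ) (noiseKernel U Ω l l') = noiseKernel U Ω l' l := by
  refine tendsto_nhds_unique (((Complex.continuous_conj.tendsto _).comp
    (tendsto_noiseKernel hA hC hE l l')).congr fun t => ?_) (tendsto_noiseKernel hA hC hE l' l)
  simp

/-- The quadratic form of the kernel is the limit of t⁻¹ times a squared norm of a combination of
word vectors. The default branch of `noiseMatrix` is thereby excluded. -/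
lemma posSemidef_noiseKernel (hA : UnitaryIncrementProcess U Ω) (hC : Gaussian U Ω)
    (hE : CoreAssumption U Ω 𝒟) :
    (Matrix.of fun l l' : Word 𝒟 => noiseKernel U Ω l l' • (1 : ℂ →L[ℂ] ℂ)).PosSemidef := by
  have key := (RKHS.posSemidef_tfae (K := Matrix.of fun l l' : Word 𝒟 =>
    noiseKernel U Ω l l' • (1 : ℂ →L[ℂ] ℂ))).out 0 2
  refine key.2 ⟨?_, fun vv => ?_⟩
  · ext l l'
    simp [Matrix.conjTranspose_apply, conj_noiseKernel hA hC hE]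
  have hlim : Tendsto (fun t : ℝ => (t : ℂ)⁻¹ *
      ⟪∑ l ∈ vv.support, vv l • wordVec U Ω t l, ∑ l ∈ vv.support, vv l • wordVec U Ω t l⟫_ℂ)
      (𝓝[>] 0) (𝓝 (vv.sum fun x w => vv.sum fun x' w' =>
        ⟪((Matrix.of fun l l' : Word 𝒟 => noiseKernel U Ω l l' • (1 : ℂ →L[ℂ] ℂ)) x' x) w, w'⟫_ℂ)) := by
    have h1 := tendsto_finsetSum vv.support fun l _ => tendsto_finsetSum vv.support fun l' _ =>
      ((tendsto_noiseKernel hA hC hE l l').const_mul ((starRingEnd ℂ) (vv l) * vv l'))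
    convert h1 using 1
    · ext t
      rw [sum_inner, Finset.mul_sum]
      refine Finset.sum_congr rfl fun l _ => ?_
      rw [inner_sum, Finset.mul_sum]
      refine Finset.sum_congr rfl fun l' _ => ?_
      rw [inner_smul_left, inner_smul_right]
      ring
    · congr 1
      simp only [Finsupp.sum]
      refine Finset.sum_congr rfl fun l _ => Finset.sum_congr rfl fun l' _ => ?_
      rw [← conj_noiseKernel hA hC hE l' l]
      simp
      ring
  have hre := (Complex.continuous_re.tendsto _).comp hlim
  refine ge_of_tendsto hre ?_
  filter_upwards [self_mem_nhdsWithin] with t ht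
  have ht0 : (0 : ℝ) < t := ht
  rw [Function.comp_apply, inner_self_eq_norm_sq_to_K, ← Complex.ofReal_inv]
  simp only [Complex.coe_algebraMap, ← Complex.ofReal_pow, ← Complex.ofReal_mul, Complex.ofReal_re]
  positivity

lemma inner_noiseEmb_eq (hA : UnitaryIncrementProcess U Ω) (hC : Gaussian U Ω)
    (hE : CoreAssumption U Ω 𝒟) (l l' : Word 𝒟) :
    ⟪noiseEmb U Ω l, noiseEmb U Ω l'⟫_ℂ = noiseKernel U Ω l l' := by
  rw [inner_noiseEmb, noiseMatrix, if_pos (posSemidef_noiseKernel hA hC hE)]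
  simp

lemma inner_eta (hA : UnitaryIncrementProcess U Ω) (hC : Gaussian U Ω)
    (hE : CoreAssumption U Ω 𝒟) (p u : h) (v w : 𝒟) :
    ⟪eta U Ω p v, eta U Ω u w⟫_ℂ = ⟪u, TraceClass.toOp h (hE.noiseOp w v) p⟫_ℂ := by
  rw [eta, eta, inner_noiseEmb_eq hA hC hE]
  refine tendsto_nhds_unique (tendsto_noiseKernel hA hC hE _ _)
    ((hE.tendsto_inner_slice hA w v u p).congr fun t => ?_)
  simp [wordVec, starIf, slice_sub, slice_one_apply]

/-- The noise part of the generators of `Z` and of `F` agree. -/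
lemma tendsto_inner_slice_adjoint (hA : UnitaryIncrementProcess U Ω) (hC : Gaussian U Ω)
    (hE : CoreAssumption U Ω 𝒟) (w v : 𝒟) (u p : h) :
    Tendsto (fun t : ℝ => (t : ℂ)⁻¹ *
      ⟪slice (adjoint (U 0 t) - 1) p v Ω, slice (adjoint (U 0 t) - 1) u w Ω⟫_ℂ)
      (𝓝[>] 0) (𝓝 ⟪u, TraceClass.toOp h (hE.noiseOp w v) p⟫_ℂ) := by
  have hv := isLittleO_slice_add_slice_adjoint hA hC (hE.tendsto_noiseOp hA v v) p
  have hw := isLittleO_slice_add_slice_adjoint hA hC (hE.tendsto_noiseOp hA w w) u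
  -- With a, b the increments of U and a', b' those of U*, one has ⟨a', b'⟩ = ⟨a, b⟩ + ⟨a', b + b'⟩
  -- - ⟨a + a', b⟩. The last two terms pair O(√t) with o(√t).
  have h1 := tendsto_inv_mul_inner (isBigO_slice hA (hE.le_domain v.2) true p) hw
  have h2 := tendsto_inv_mul_inner (isBigO_slice hA (hE.le_domain w.2) false u) hv
  have h3 := (Complex.continuous_conj.tendsto _).comp h2
  rw [map_zero] at h3
  have h4 := ((hE.tendsto_inner_slice hA w v u p).add h1).sub h3
  rw [add_zero, sub_zero] at h4
  refine h4.congr fun t => ?_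
  simp only [Function.comp_apply, map_mul, map_add, map_inv₀, Complex.conj_ofReal,
    inner_conj_symm, inner_add_right, starIf, ↓reduceIte, Bool.false_eq_true]
  ring

end NoiseKernel

/-! ### The coefficients L_j, the two generators and Feller's condition -/

section Feller

variable {h H : Type*} [NormedAddCommGroup h] [InnerProductSpace ℂ h] [CompleteSpace h]
variable [NormedAddCommGroup H] [InnerProductSpace ℂ H] [CompleteSpace H]
variable {U : ℝ → ℝ → HTensor h H →L[ℂ] HTensor h H} {Ω : H} {𝒟 : Submodule ℂ h}

open ContinuousLinearMap (adjoint)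

/-- The inner products depend on the first argument through matrix entries of `noiseOp`, so the
difference of the two sides has norm 0. -/
lemma eta_add (hA : UnitaryIncrementProcess U Ω) (hC : Gaussian U Ω) (hE : CoreAssumption U Ω 𝒟)
    (u u' : h) (v : 𝒟) : eta U Ω (u + u') v = eta U Ω u v + eta U Ω u' v := by
  rw [← sub_eq_zero, ← inner_self_eq_zero (𝕜 := ℂ)]
  simp only [inner_sub_left, inner_sub_right, inner_add_left, inner_add_right,
    inner_eta hA hC hE, map_add]
  ring

lemma eta_smul (hA : UnitaryIncrementProcess U Ω) (hC : Gaussian U Ω) (hE : CoreAssumption U Ω 𝒟)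
    (c : ℂ) (u : h) (v : 𝒟) : eta U Ω (c • u) v = (starRingEnd ℂ) c • eta U Ω u v := by
  rw [← sub_eq_zero, ← inner_self_eq_zero (𝕜 := ℂ)]
  simp only [inner_sub_left, inner_sub_right, inner_smul_left, inner_smul_right,
    inner_eta hA hC hE, map_smul, Complex.conj_conj]
  ring

lemma norm_eta_sq (hA : UnitaryIncrementProcess U Ω) (hC : Gaussian U Ω)
    (hE : CoreAssumption U Ω 𝒟) (u : h) (v : 𝒟) :
    ‖eta U Ω u v‖ ^ 2 = ‖⟪u, TraceClass.toOp h (hE.noiseOp v v) u⟫_ℂ‖ := by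
  rw [← inner_eta hA hC hE, inner_self_eq_norm_sq_to_K]
  simp

lemma norm_eta_le (hA : UnitaryIncrementProcess U Ω) (hC : Gaussian U Ω)
    (hE : CoreAssumption U Ω 𝒟) (u : h) (v : 𝒟) :
    ‖eta U Ω u v‖ ≤ √‖hE.noiseOp v v‖ * ‖u‖ := by
  refine le_of_sq_le_sq ?_ (by positivity)
  rw [norm_eta_sq hA hC hE, mul_pow, Real.sq_sqrt (norm_nonneg _)]
  have := (hE.noiseOp v v).norm_inner_le u u
  linarith

variable {ι : Type*} (e : HilbertBasis ι ℂ (NoiseSpace U Ω 𝒟))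

/-- The defining property of the coefficients `L_j`. -/
lemma inner_coeffL (hA : UnitaryIncrementProcess U Ω) (hC : Gaussian U Ω)
    (hE : CoreAssumption U Ω 𝒟) (j : ι) (v : 𝒟) (u : h) :
    ⟪u, coeffL e j v⟫_ℂ = ⟪e j, eta U Ω u v⟫_ℂ := by
  have hx : ∃ x : h, ∀ u : h, ⟪u, x⟫_ℂ = ⟪e j, eta U Ω u v⟫_ℂ := by
    -- Since `eta` is conjugate linear and bounded in u, this functional is linear and bounded, and
    -- Riesz supplies the vector; `coeffL` thus never takes its default value.
    set ℓ : h →L[ℂ] ℂ := LinearMap.mkContinuous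
      { toFun := fun u => ⟪eta U Ω u v, e j⟫_ℂ
        map_add' := fun u u' => by rw [eta_add hA hC hE, inner_add_left]
        map_smul' := fun c u => by
          rw [eta_smul hA hC hE, inner_smul_left, Complex.conj_conj, RingHom.id_apply, smul_eq_mul] }
      (√‖hE.noiseOp v v‖) (fun u => by
        refine (norm_inner_le_norm (𝕜 := ℂ) (eta U Ω u v) (e j)).trans ?_
        rw [e.orthonormal.1 j, mul_one]
        exact norm_eta_le hA hC hE u v) with hℓ
    refine ⟨(InnerProductSpace.toDual ℂ h).symm ℓ, fun u => ?_⟩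
    rw [← inner_conj_symm (𝕜 := ℂ) u, InnerProductSpace.toDual_symm_apply,
      ← inner_conj_symm (𝕜 := ℂ) (e j)]
    rfl
  rw [coeffL, dif_pos hx]
  exact hx.choose_spec u

/-- Finitely many vectors L_j v span a finite dimensional space. Computing their norms in an
orthonormal basis of it and exchanging sums, Bessel for e leaves diagonal entries of `noiseOp v v`,
whose sum is at most the trace norm. -/
lemma summable_norm_coeffL_sq (hA : UnitaryIncrementProcess U Ω) (hC : Gaussian U Ω)
    (hE : CoreAssumption U Ω 𝒟) (v : 𝒟) : Summable fun j => ‖coeffL e j v‖ ^ 2 := by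
  classical
  refine summable_of_sum_le (c := ‖hE.noiseOp v v‖) (fun _ => by positivity) fun s => ?_
  set S : Submodule ℂ h := Submodule.span ℂ ((fun j => coeffL e j v) '' s) with hS
  have : FiniteDimensional ℂ S := FiniteDimensional.span_of_finite ℂ (s.finite_toSet.image _)
  set b := stdOrthonormalBasis ℂ S with hb
  have hbo : Orthonormal ℂ (fun k => (b k : h)) :=
    b.orthonormal.comp_linearIsometry S.subtypeₗᵢ
  have hnorm : ∀ j ∈ s, ‖coeffL e j v‖ ^ 2 = ∑ k, ‖⟪e j, eta U Ω (b k : h) v⟫_ℂ‖ ^ 2 :=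
    fun j hj => by
      have hmem : coeffL e j v ∈ S := Submodule.subset_span ⟨j, hj, rfl⟩
      have := b.sum_sq_norm_inner_right ⟨coeffL e j v, hmem⟩
      rw [Submodule.coe_norm] at this
      rw [← this]
      refine Finset.sum_congr rfl fun k _ => ?_
      rw [Submodule.coe_inner, inner_coeffL e hA hC hE]
  calc ∑ j ∈ s, ‖coeffL e j v‖ ^ 2
      = ∑ k, ∑ j ∈ s, ‖⟪e j, eta U Ω (b k : h) v⟫_ℂ‖ ^ 2 := by
        rw [Finset.sum_congr rfl hnorm, Finset.sum_comm]
    _ ≤ ∑ k, ‖⟪(b k : h), TraceClass.toOp h (hE.noiseOp v v) (b k : h)⟫_ℂ‖ := by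
        refine Finset.sum_le_sum fun k _ => ?_
        rw [← norm_eta_sq hA hC hE]
        exact e.orthonormal.sum_inner_products_le _
    _ ≤ ‖hE.noiseOp v v‖ := TraceClass.sum_le_norm _ hbo hbo

/-- Entrywise this is Parseval in the noise space; square summability of the norms ‖L_j v‖ upgrades
it to the trace norm, so that Tr(x ·) may be applied for any bounded x. -/
lemma hasSum_rankOne_coeffL (hA : UnitaryIncrementProcess U Ω) (hC : Gaussian U Ω)
    (hE : CoreAssumption U Ω 𝒟) (w v : 𝒟) :
    HasSum (fun j => TraceClass.rankOne (coeffL e j w) (coeffL e j v)) (hE.noiseOp w v) := by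
  refine TraceClass.hasSum_rankOne (summable_norm_mul_norm (summable_norm_coeffL_sq e hA hC hE w)
    (summable_norm_coeffL_sq e hA hC hE v)) fun u p => ?_
  rw [← inner_eta hA hC hE, ← e.tsum_inner_mul_inner]
  refine tsum_congr fun j => ?_
  rw [inner_coeffL e hA hC hE, ← inner_conj_symm (coeffL e j v), inner_coeffL e hA hC hE,
    inner_conj_symm, mul_comm]

lemma tracePair_noiseOp (hA : UnitaryIncrementProcess U Ω) (hC : Gaussian U Ω)
    (hE : CoreAssumption U Ω 𝒟) (w v : 𝒟) (x : h →L[ℂ] h) :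
    TraceClass.tracePair x (hE.noiseOp w v) = ∑' j, ⟪coeffL e j v, x (coeffL e j w)⟫_ℂ := by
  rw [← ((TraceClass.tracePair x).hasSum (hasSum_rankOne_coeffL e hA hC hE w v)).tsum_eq]
  simp

/-- The generator of `Z` on rank one operators. -/
lemma CoreAssumption.hasGenerator_Z (hE : CoreAssumption U Ω 𝒟) (w v : 𝒟) :
    HasGenerator (semigroupZ U Ω) (TraceClass.rankOne (w : h) (v : h))
      (TraceClass.rankOne (restrictTo (genG U Ω) hE.le_domain w) (v : h)
        + TraceClass.rankOne (w : h) (restrictTo (genG U Ω) hE.le_domain v) + hE.noiseOp w v) := by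
  have h1 := generator_apply (T := semigroupZ U Ω) ⟨_, hE.rankOne_mem_domain_Z w v⟩
  have h2 : generator (semigroupZ U Ω) ⟨_, hE.rankOne_mem_domain_Z w v⟩ =
      TraceClass.rankOne (restrictTo (genG U Ω) hE.le_domain w) (v : h)
        + TraceClass.rankOne (w : h) (restrictTo (genG U Ω) hE.le_domain v) + hE.noiseOp w v := by
    rw [noiseOp]
    abel
  rwa [h2] at h1

lemma inner_adjoint_expSemigroup (t : ℝ) (u v : h) :
    ⟪u, adjoint (expSemigroup U Ω t) v⟫_ℂ = ⟪Ω, slice (adjoint (U 0 t)) u v Ω⟫_ℂ := by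
  rw [ContinuousLinearMap.adjoint_inner_right, ← inner_conj_symm, inner_expSemigroup,
    inner_conj_symm, slice_inner]

/-- The generator of `F` on rank one operators. -/
lemma CoreAssumption.hasGenerator_F (hA : UnitaryIncrementProcess U Ω) (hC : Gaussian U Ω)
    (hE : CoreAssumption U Ω 𝒟) (w v : 𝒟) :
    HasGenerator (semigroupF U Ω) (TraceClass.rankOne (w : h) (v : h))
      (TraceClass.rankOne (restrictTo (genG U Ω).adjoint hE.le_adjoint_domain w) (v : h)
        + TraceClass.rankOne (w : h) (restrictTo (genG U Ω).adjoint hE.le_adjoint_domain v)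
        + hE.noiseOp w v) := by
  have h1 := generator_apply (T := semigroupF U Ω) ⟨_, hE.rankOne_mem_domain_F w v⟩
  have hd : Dense ((generator (expSemigroup U Ω)).domain : Set h) := hE.dense.mono hE.le_domain
  have hadj : ∀ (z : 𝒟) (u : h), Tendsto
      (fun t : ℝ => (t : ℂ)⁻¹ * ⟪u, adjoint (expSemigroup U Ω t) z - z⟫_ℂ) (𝓝[>] 0)
      (𝓝 ⟪u, restrictTo (genG U Ω).adjoint hE.le_adjoint_domain z⟫_ℂ) := fun z u =>
    tendsto_inner_adjoint_generator hA.contractiveOrbit_expSemigroup hd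
      ⟨z, hE.le_adjoint_domain z.2⟩ u
  convert h1 using 1
  -- The core assumption already provides a trace norm limit, so it only has to be identified entry
  -- by entry. This matters because the derivative of T_t* is available only weakly.
  refine TraceClass.ext_inner fun u p => ?_
  refine tendsto_nhds_unique ?_ (((TraceClass.entry u p).continuous.tendsto _).comp h1)
  have h2 := tendsto_inner_slice_adjoint hA hC hE w v u p
  have h3 := (hadj w u).mul_const ⟪(v : h), p⟫_ℂ
  have h4 := ((Complex.continuous_conj.tendsto _).comp (hadj v p)).const_mul ⟪u, (w : h)⟫_ℂ
  have h5 := (h3.add h4).add h2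
  rw [map_add, map_add, add_apply, add_apply, inner_add_right, inner_add_right,
    TraceClass.toOp_rankOne, TraceClass.toOp_rankOne, inner_smul_right, inner_smul_right,
    mul_comm ⟪(v : h), p⟫_ℂ, mul_comm _ ⟪u, (w : h)⟫_ℂ]
  rw [inner_conj_symm] at h5
  refine h5.congr fun t => ?_
  rw [← inner_channel_rankOne, channel_sub_one_rankOne hA.inner_vacuum (adjoint (U 0 t))
    (inner_adjoint_expSemigroup t), Function.comp_apply, Function.comp_apply, semigroupF_eq]
  simp only [map_smul, map_sub, sub_apply, TraceClass.entry_apply,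
    TraceClass.toOp_rankOne, inner_sub_right, inner_sub_left, inner_smul_right, smul_eq_mul,
    map_mul, map_inv₀, Complex.conj_ofReal, inner_conj_symm]
  ring

/-- Feller's condition for a contraction semigroup on the trace class operators whose generator
has a core of finite rank operators. -/
lemma fellerSet_eq_zero {T : ℝ → TraceClass h →L[ℂ] TraceClass h} (h𝒟 : Dense (𝒟 : Set h))
    (hcore : (generator T).HasCore (rankOneSpan 𝒟))
    (hT : ∀ ρ ∈ finiteRankClosure h, ContractiveOrbit T ρ)
    {A : 𝒟 → h} {L : ι → 𝒟 → h} {R : 𝒟 → 𝒟 → TraceClass h}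
    (hgen : ∀ w v : 𝒟, HasGenerator T (TraceClass.rankOne (w : h) (v : h))
      (TraceClass.rankOne (A w) (v : h) + TraceClass.rankOne (w : h) (A v) + R w v))
    (hR : ∀ w v x, TraceClass.tracePair x (R w v) = ∑' j, ⟪L j v, x (L j w)⟫_ℂ)
    {lam : ℝ} (hlam : 0 < lam) : fellerSet A L lam = {0} := by
  refine Set.eq_singleton_iff_unique_mem.2
    ⟨⟨ContinuousLinearMap.isPositive_zero, fun v w => by simp⟩, ?_⟩
  rintro x ⟨-, hx⟩
  set φ := TraceClass.tracePair x with hφ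
  -- On |w⟩⟨v| the Feller identity is exactly φ(ℒρ) = λφ(ρ), the sum over j being the trace of x
  -- against the noise part.
  have hspan : ∀ ρ ∈ rankOneSpan 𝒟, ∃ y, HasGenerator T ρ y ∧ φ y = lam * φ ρ := fun ρ hρ => by
    induction hρ using Submodule.span_induction with
    | mem ρ hρ =>
      obtain ⟨w, hw, v, hv, rfl⟩ := hρ
      refine ⟨_, hgen ⟨w, hw⟩ ⟨v, hv⟩, ?_⟩
      rw [map_add, map_add, hR, hφ, TraceClass.tracePair_rankOne, TraceClass.tracePair_rankOne,
        TraceClass.tracePair_rankOne]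
      exact (hx ⟨v, hv⟩ ⟨w, hw⟩).2
    | zero => exact ⟨0, by simp [HasGenerator], by simp⟩
    | add ρ σ _ _ hρ hσ =>
      obtain ⟨y, hy, hy'⟩ := hρ
      obtain ⟨z, hz, hz'⟩ := hσ
      exact ⟨y + z, hy.add hz, by rw [map_add, map_add, hy', hz', mul_add]⟩
    | smul c ρ _ hρ =>
      obtain ⟨y, hy, hy'⟩ := hρ
      exact ⟨c • y, hy.smul c, by simp only [map_smul, smul_eq_mul, hy']; ring⟩
  have hclosure : ∀ a b, HasGenerator T a b →
      (a, b) ∈ closure {p : TraceClass h × TraceClass h |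
        ∃ s : (generator T).domain, (s : TraceClass h) ∈ rankOneSpan 𝒟 ∧ p = (↑s, generator T s)} :=
    fun a b hab => by
      have h1 := mem_closure_graph_of_hasCore hcore ⟨a, hab.mem_domain⟩
      rwa [(generator_apply ⟨a, hab.mem_domain⟩).unique hab] at h1
  have heigen : ∀ a b, HasGenerator T a b → φ b = lam * φ a := fun a b hab => by
    -- The eigenvalue relation is a closed condition on the graph, so it passes from the core to the
    -- whole domain; the orbit of |w⟩⟨v| leaves the core span in general, hence the need for this.
    have hcl : IsClosed {p : TraceClass h × TraceClass h | φ p.2 = lam * φ p.1} :=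
      isClosed_eq (by fun_prop) (by fun_prop)
    refine hcl.closure_subset_iff.2 ?_ (hclosure a b hab)
    rintro _ ⟨s, hs, rfl⟩
    obtain ⟨y, hy, hy'⟩ := hspan s hs
    change φ (generator T s) = lam * φ s
    rw [(generator_apply s).unique hy, hy']
  have hzero : ∀ w ∈ 𝒟, ∀ v ∈ 𝒟, ⟪v, x w⟫_ℂ = 0 := fun w hw v hv => by
    rw [← TraceClass.tracePair_rankOne]
    exact (hT _ (rankOne_mem_finiteRankClosure w v)).eq_zero_of_eigen
      (hgen ⟨w, hw⟩ ⟨v, hv⟩) φ hlam heigen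
  refine ContinuousLinearMap.ext_on (h𝒟.mono Submodule.subset_span) fun w hw => ?_
  exact h𝒟.eq_zero_of_inner_right ℂ fun v hv => hzero w hw v hv

end Feller

end QUnitary

end

open QUnitary in
theorem lemma5p2 {h H : Type*}
    [NormedAddCommGroup h] [InnerProductSpace ℂ h] [CompleteSpace h]
    [TopologicalSpace.SeparableSpace h]
    [NormedAddCommGroup H] [InnerProductSpace ℂ H] [CompleteSpace H]
    [TopologicalSpace.SeparableSpace H]
    (U : ℝ → ℝ → HTensor h H →L[ℂ] HTensor h H) (Ω : H)
    (hA : UnitaryIncrementProcess U Ω) (hB : WeaklyContinuous U Ω) (hC : Gaussian U Ω)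
    (𝒟 : Submodule ℂ h) (hE : CoreAssumption U Ω 𝒟)
    {ι : Type*} (e : HilbertBasis ι ℂ (NoiseSpace U Ω 𝒟)) :
    ∃ lam : ℝ, 0 < lam ∧
      fellerSet (restrictTo (genG U Ω) hE.le_domain) (coeffL e) lam = {0} ∧
      fellerSet (restrictTo (genG U Ω).adjoint hE.le_adjoint_domain) (coeffL e) lam = {0} :=
  -- Every positive λ works; 1 is a convenient choice.
  ⟨1, one_pos,
    fellerSet_eq_zero hE.dense hE.core_Z (fun _ hρ => hA.contractiveOrbit_channel false hρ)
      hE.hasGenerator_Z (tracePair_noiseOp e hA hC hE) one_pos,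
    fellerSet_eq_zero hE.dense hE.core_F (fun _ hρ => hA.contractiveOrbit_channel true hρ)
      (hE.hasGenerator_F hA hC) (tracePair_noiseOp e hA hC hE) one_pos⟩
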